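/- Let $K$ be a countable index set. A weight is a function $m\colon K\to(0,\infty)$; products, quotients and square roots of weights are taken pointwise. For $1\le p\le\infty$ let $\ell^p_m(K)=\{c\in\mathbb C^K : m\cdot c\in\ell^p(K)\}$ with norm $\|c\|_{\ell^p_m}=\|m\cdot c\|_{\ell^p}$. An *ARI-algebra* is a Banach $*$-algebra $\mathcal A$ of matrices over $K$ (containing the identity matrix, with the conjugate transpose as involution), together with a class $W$ of weights, called $\mathcal A$-admissible, such that (1) $1\in W$; if $m\in W$ then $1/m\in W$; and every $A\in\mathcal A$ defines a bounded operator on $\ell^p_m(K)$ for all $1\le p\le\infty$ and $m\in W$; (2) $\mathcal A$ is inverse-closed in $\mathcal B(\ell^2(K))$: if $A\in\mathcal A$ is invertible on $\ell^2(K)$, then $A^{-1}\in\mathcal A$. Let $\Psi=(\psi_k)_{k\in K}$ be a frame for a complex Hilbert space $\mathcal H$, with frame operator $S_\Psi f=\sum_k\langle f,\psi_k\rangle\psi_k$, canonical dual frame $\tilde\psi_k=S_\Psi^{-1}\psi_k$ and Gram matrix $(G_\Psi)_{kl}=\langle\psi_l,\psi_k\rangle$. The frame $\Psi$ is *$\mathcal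 A$-localized* if $G_\Psi\in\mathcal A$. Let $\mathcal H^{00}=\operatorname{span}\{\psi_k:k\in K\}$ and $C_{\tilde\Psi}f=(\langle f,\tilde\psi_k\rangle)_{k}$. For $1\le p<\infty$ the *coorbit space* $\mathcal H^p_m$ is the completion of $\mathcal H^{00}$ in the norm $\|f\|_{\mathcal H^p_m}=\|C_{\tilde\Psi}f\|_{\ell^p_m}$. The space $\mathcal H^\infty_m$ is the weak-$*$ completion: its elements are the classes of sequences $(f_n)$ in $\mathcal H^{00}$ with $\sup_n\|C_{\tilde\Psi}f_n\|_{\ell^\infty_m}<\infty$ for which $\langle f,\tilde\psi_k\rangle:=\lim_n\langle f_n,\tilde\psi_k\rangle$ exists for every $k$, two sequences being identified if these limits agree, with norm $\sup_k m_k|\langle f,\tilde\psi_k\rangle|$. The functionals $\langle\cdot,\tilde\psi_k\rangle$ extend to $\mathcal H^p_m$; for $f\in\mathcal H^p_m$ put $\langle f,\psi_k\rangle=\sum_l\langle f,\tilde\psi_l\rangle\langle\psi_l,\psi_k\rangle$, and for $f\in \mathcal H^\infty_m$, $g\in\mathcal H^1_{1/m}$ put $\langle f,g\rangle=\sum_k\langle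 f,\tilde\psi_k\rangle\overline{\langle g,\psi_k\rangle}$. For a weight $\mu$, the *frame multiplier* is $$M_{\mu,\Psi}f=\sum_{k\in K}\mu_k\langle f,\psi_k\rangle\psi_k ,$$ where, as a map from $\mathcal H^p_{m}$ to $\mathcal H^p_{w}$, the series is required to converge unconditionally in the norm of $\mathcal H^p_w$ if $p<\infty$, and unconditionally in the weak-$*$ sense (tested against $\mathcal H^1_{1/w}$) if $p=\infty$. **Theorem (Abstract lifting theorem for coorbit spaces).** Let $\mathcal A$ be an ARI-algebra, let $\mu$ and $m$ be weights such that $\mu$, $m\sqrt\mu$ and $m/\sqrt\mu$ are $\mathcal A$-admissible, and let $\Psi$ be an $\mathcal A$-localized frame for which also $G_\Psi^\mu:=\operatorname{diag}(\mu)\,G_\Psi\,\operatorname{diag}(1/\mu)\in\mathcal A$. Then for every $1\le p\le\infty$ the spaces $\mathcal H^p_{m\sqrt\mu}$ and $\mathcal H^p_{m/\sqrt\mu}$ are well-defined Banach spaces (containing all the vectors $\psi_k$), the frame multiplier $M_{\mu,\Psi}$ is well defined and is a Banach space isomorphism (a bounded linear bijection with bounded inverse) from $\mathcal H^p_{m\sqrt\mu}$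 onto $\mathcal H^p_{m/\sqrt\mu}$, and the frame multiplier $M_{1/\mu,\Psi}$ is well defined and is a Banach space isomorphism from $\mathcal H^p_{m/\sqrt\mu}$ onto $\mathcal H^p_{m\sqrt\mu}$. -/

import Mathlib

open scoped ENNReal ComplexConjugate InnerProductSpace

noncomputable section

universe u v

/-! ## Weights -/

/-- A (strictly positive) weight on the index set `K`. -/
structure PosWeight (K : Type u) where
  /-- the values of the weight -/
  val : K → ℝ
  pos : ∀ k, 0 < val k

namespace PosWeight

variable {K : Type u}

instance : CoeFun (PosWeight K) (fun _ => K → ℝ) := ⟨PosWeight.val⟩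

/-- The constant weight `1`. -/
instance : One (PosWeight K) := ⟨⟨fun _ => 1, fun _ => one_pos⟩⟩

/-- Pointwise reciprocal `1 / m`. -/
instance : Inv (PosWeight K) := ⟨fun m => ⟨fun k => (m k)⁻¹, fun k => inv_pos.2 (m.pos k)⟩⟩

/-- Pointwise product. -/
instance : Mul (PosWeight K) :=
  ⟨fun m w => ⟨fun k => m k * w k, fun k => mul_pos (m.pos k) (w.pos k)⟩⟩

/-- Pointwise quotient. -/
instance : Div (PosWeight K) :=
  ⟨fun m w => ⟨fun k => m k / w k, fun k => div_pos (m.pos k) (w.pos k)⟩⟩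

/-- Pointwise square root. -/
def sqrt (m : PosWeight K) : PosWeight K :=
  ⟨fun k => Real.sqrt (m k), fun k => Real.sqrt_pos.2 (m.pos k)⟩

end PosWeight

/-! ## Weighted sequence spaces -/

/-- Multiplication of a sequence by a weight, `(diag(m) c)_k = m_k c_k`. -/
def diagMul {K : Type u} (m : PosWeight K) :
    PreLp (fun _ : K => ℂ) →ₗ[ℂ] PreLp (fun _ : K => ℂ) where
  toFun c := fun k => (m k : ℂ) * c k
  map_add' c d := by
    funext k
    exact mul_add _ _ _
  map_smul' a c := by
    funext k
    exact mul_left_comm _ _ _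

/-- The weighted space `ℓ^p_m(K)` of all `c : K → ℂ` with `m · c ∈ ℓ^p(K)`. -/
def WeightedLp {K : Type u} (m : PosWeight K) (p : ℝ≥0∞) :
    Submodule ℂ (PreLp (fun _ : K => ℂ)) :=
  (lpSubmodule ℂ (fun _ : K => ℂ) p).comap (diagMul m)

namespace WeightedLp

variable {K : Type u} (m : PosWeight K) (p : ℝ≥0∞)

/-- The map `c ↦ m · c` from `ℓ^p_m(K)` to `ℓ^p(K)`. -/
def toLp : WeightedLp m p →ₗ[ℂ] lp (fun _ : K => ℂ) p where
  toFun c := ⟨diagMul m c.1, c.2⟩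
  map_add' c d := Subtype.ext (map_add (diagMul m) c.1 d.1)
  map_smul' a c := Subtype.ext (map_smul (diagMul m) a c.1)

theorem toLp_injective : Function.Injective (toLp m p) := by
  intro c d h
  apply Subtype.ext
  funext k
  have h1 : (m k : ℂ) * c.1 k = (m k : ℂ) * d.1 k := congrFun (congrArg Subtype.val h) k
  exact mul_left_cancel₀ (Complex.ofReal_ne_zero.2 (m.pos k).ne') h1

variable [Fact (1 ≤ p)]

/-- The norm `‖c‖_{ℓ^p_m} = ‖m · c‖_{ℓ^p}`. -/
instance : NormedAddCommGroup (WeightedLp m p) :=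
  NormedAddCommGroup.induced (WeightedLp m p) (lp (fun _ : K => ℂ) p) (toLp m p)
    (toLp_injective m p)

instance : NormedSpace ℂ (WeightedLp m p) :=
  NormedSpace.induced ℂ (WeightedLp m p) (lp (fun _ : K => ℂ) p) (toLp m p)

theorem norm_def (c : WeightedLp m p) : ‖c‖ = ‖toLp m p c‖ := rfl

end WeightedLp

/-! ## Matrices over `K` and ARI-algebras -/

/-- The matrix `M` acts as a bounded operator on `ℓ^p_m(K)`: for every `c ∈ ℓ^p_m` the series
`∑_l M_{kl} c_l` converge, they define an element `d` of `ℓ^p_m`, and `‖d‖ ≤ C ‖c‖`. -/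
def ActsBoundedly {K : Type u} (M : Matrix K K ℂ) (p : ℝ≥0∞) [Fact (1 ≤ p)]
    (m : PosWeight K) : Prop :=
  ∃ C : ℝ, ∀ c : WeightedLp m p, ∃ d : WeightedLp m p,
    (∀ k, HasSum (fun l => M k l * c.1 l) (d.1 k)) ∧ ‖d‖ ≤ C * ‖c‖

open scoped Classical in
/-- The matrix `(⟨T e_l, e_k⟩)_{kl}` of a bounded operator on `ℓ²(K)`. -/
def opMatrix {K : Type u}
    (T : lp (fun _ : K => ℂ) 2 →L[ℂ] lp (fun _ : K => ℂ) 2) : Matrix K K ℂ :=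
  fun k l => T (lp.single 2 l 1) k

/-- An ARI-algebra over `K`: a unital Banach `*`-algebra of matrices over `K` with a class `W` of
admissible weights, satisfying regularity and inverse-closedness. Since the constant weight `1` is
admissible, every matrix of the algebra is bounded on `ℓ²(K)`; the algebra is recorded as the
`*`-algebra of the corresponding operators (operator product and adjoint are matrix product and
conjugate transpose), endowed with a complete submultiplicative norm of its own. -/
structure ARIAlgebra (K : Type u) where
  /-- the underlying unital `*`-algebra -/
  alg : StarSubalgebra ℂ (lp (fun _ : K => ℂ) 2 →L[ℂ] lp (fun _ : K => ℂ) 2)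
  /-- the Banach algebra norm -/
  algNorm : AlgebraNorm ℂ alg
  complete : ∀ a : ℕ → alg,
    (∀ ε : ℝ, 0 < ε → ∃ N, ∀ i ≥ N, ∀ j ≥ N, algNorm (a i - a j) < ε) →
    ∃ b : alg, Filter.Tendsto (fun i => algNorm (a i - b)) Filter.atTop (nhds 0)
  /-- the class of admissible weights -/
  W : Set (PosWeight K)
  one_mem : 1 ∈ W
  inv_mem : ∀ m ∈ W, m⁻¹ ∈ W
  /-- regularity -/
  regular : ∀ T ∈ alg, ∀ m ∈ W, ∀ (p : ℝ≥0∞) [Fact (1 ≤ p)], ActsBoundedly (opMatrix T) p m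
  /-- inverse-closedness in the bounded operators on `ℓ²(K)` -/
  inverse_closed : ∀ T ∈ alg, IsUnit T → Ring.inverse T ∈ alg

/-- The matrix `M` belongs to the matrix algebra `A`. -/
def ARIAlgebra.MemMatrix {K : Type u} (A : ARIAlgebra K) (M : Matrix K K ℂ) : Prop :=
  ∃ T ∈ A.alg, opMatrix T = M

/-- The conjugated matrix `M^μ = diag(μ) M diag(1/μ)`. -/
def conjDiag {K : Type u} (μ : PosWeight K) (M : Matrix K K ℂ) : Matrix K K ℂ :=
  fun k l => (μ k : ℂ) * M k l * ((μ l)⁻¹ : ℝ)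

/-! ## Frames -/

/-- A frame `(ψ_k)_{k ∈ K}` of the Hilbert space `H`. -/
structure HilbertFrame (K : Type u) (H : Type v) [NormedAddCommGroup H]
    [InnerProductSpace ℂ H] where
  /-- the frame vectors -/
  vec : K → H
  isFrame : ∃ a b : ℝ, 0 < a ∧ 0 < b ∧ ∀ f : H,
    (Summable fun k => ‖⟪vec k, f⟫_ℂ‖ ^ 2) ∧
    a * ‖f‖ ^ 2 ≤ ∑' k, ‖⟪vec k, f⟫_ℂ‖ ^ 2 ∧ ∑' k, ‖⟪vec k, f⟫_ℂ‖ ^ 2 ≤ b * ‖f‖ ^ 2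

namespace HilbertFrame

variable {K : Type u} {H : Type v} [NormedAddCommGroup H] [InnerProductSpace ℂ H]
variable (Ψ : HilbertFrame K H)

theorem memlp_coeff (f : H) : Memℓp (fun k => ⟪Ψ.vec k, f⟫_ℂ) 2 := by
  obtain ⟨a, b, -, -, h⟩ := Ψ.isFrame
  refine memℓp_gen ?_
  simpa using (h f).1

/-- The analysis operator as a linear map. -/
def analysisLin : H →ₗ[ℂ] lp (fun _ : K => ℂ) 2 where
  toFun f := ⟨fun k => ⟪Ψ.vec k, f⟫_ℂ, Ψ.memlp_coeff f⟩
  map_add' f g := by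
    apply Subtype.ext
    funext k
    exact inner_add_right _ _ _
  map_smul' c f := by
    apply Subtype.ext
    funext k
    exact inner_smul_right _ _ _

theorem norm_sq_analysisLin (f : H) :
    ‖Ψ.analysisLin f‖ ^ 2 = ∑' k, ‖⟪Ψ.vec k, f⟫_ℂ‖ ^ 2 := by
  have h := lp.norm_rpow_eq_tsum (p := 2) (by norm_num) (Ψ.analysisLin f)
  simpa [analysisLin] using h

theorem analysisLin_bound : ∃ C : ℝ, ∀ f : H, ‖Ψ.analysisLin f‖ ≤ C * ‖f‖ := by
  obtain ⟨a, b, -, hb, h⟩ := Ψ.isFrame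
  refine ⟨Real.sqrt b, fun f => ?_⟩
  refine (abs_le_of_sq_le_sq' ?_ (by positivity)).2
  rw [norm_sq_analysisLin, mul_pow, Real.sq_sqrt hb.le]
  exact (h f).2.2

/-- The analysis operator `C_Ψ : H → ℓ²(K)`, `(C_Ψ f)_k = ⟨f, ψ_k⟩`. -/
def analysis : H →L[ℂ] lp (fun _ : K => ℂ) 2 :=
  Ψ.analysisLin.mkContinuousOfExistsBound Ψ.analysisLin_bound

theorem analysis_apply (f : H) (k : K) : Ψ.analysis f k = ⟪Ψ.vec k, f⟫_ℂ := rfl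

/-- The Gram matrix `(G_Ψ)_{kl} = ⟨ψ_l, ψ_k⟩`. -/
def gram : Matrix K K ℂ := fun k l => ⟪Ψ.vec k, Ψ.vec l⟫_ℂ

variable [CompleteSpace H]

/-- The frame operator `S_Ψ = D_Ψ C_Ψ`, where `D_Ψ = C_Ψ^*`. -/
def frameOp : H →L[ℂ] H := Ψ.analysis.adjoint ∘L Ψ.analysis

theorem inner_frameOp (g f : H) :
    ⟪g, Ψ.frameOp f⟫_ℂ = ⟪Ψ.analysis g, Ψ.analysis f⟫_ℂ := by
  rw [frameOp, ContinuousLinearMap.comp_apply, ContinuousLinearMap.adjoint_inner_right]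

open scoped Classical in
/-- `S_Ψ f = ∑_k ⟨f, ψ_k⟩ ψ_k`. -/
theorem hasSum_frameOp (f : H) : HasSum (fun k => ⟪Ψ.vec k, f⟫_ℂ • Ψ.vec k) (Ψ.frameOp f) := by
  have h1 := lp.hasSum_single (p := 2) (by norm_num) (Ψ.analysis f)
  have h2 := h1.mapL Ψ.analysis.adjoint
  have h3 : ∀ k, Ψ.analysis.adjoint (lp.single 2 k (Ψ.analysis f k))
      = ⟪Ψ.vec k, f⟫_ℂ • Ψ.vec k := by
    intro k
    refine ext_inner_left ℂ fun g => ?_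
    rw [ContinuousLinearMap.adjoint_inner_right, lp.inner_single_right, inner_smul_right,
      analysis_apply, analysis_apply, ← inner_conj_symm g]
    simp
  simp only [h3] at h2
  exact h2

theorem isUnit_frameOp : IsUnit Ψ.frameOp := by
  obtain ⟨a, b, ha, -, h⟩ := Ψ.isFrame
  refine ContinuousLinearMap.isUnit_of_forall_le_norm_inner_map Ψ.frameOp
    (c := ⟨a, ha.le⟩) ha fun f => ?_
  rw [← inner_conj_symm, RCLike.norm_conj, inner_frameOp, inner_self_eq_norm_sq_to_K]
  have h1 : ‖Ψ.analysis f‖ ^ 2 = ∑' k, ‖⟪Ψ.vec k, f⟫_ℂ‖ ^ 2 := Ψ.norm_sq_analysisLin f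
  rw [norm_pow, RCLike.norm_ofReal, abs_norm, h1, mul_comm]
  exact (h f).2.1

/-- The canonical dual frame `ψ̃_k = S_Ψ⁻¹ ψ_k`. -/
def dual (k : K) : H := (Ring.inverse Ψ.frameOp) (Ψ.vec k)

theorem frameOp_inverse (f : H) : Ψ.frameOp ((Ring.inverse Ψ.frameOp) f) = f := by
  have h := Ring.mul_inverse_cancel Ψ.frameOp Ψ.isUnit_frameOp
  exact congrArg (fun T : H →L[ℂ] H => T f) h

theorem frameOp_dual (k : K) : Ψ.frameOp (Ψ.dual k) = Ψ.vec k := Ψ.frameOp_inverse _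

theorem inner_inverse_frameOp (g f : H) :
    ⟪(Ring.inverse Ψ.frameOp) g, f⟫_ℂ = ⟪g, (Ring.inverse Ψ.frameOp) f⟫_ℂ := by
  have hS : ∀ x y : H, ⟪Ψ.frameOp x, y⟫_ℂ = ⟪x, Ψ.frameOp y⟫_ℂ := by
    intro x y
    rw [← inner_conj_symm, inner_frameOp, inner_frameOp, inner_conj_symm]
  calc ⟪(Ring.inverse Ψ.frameOp) g, f⟫_ℂ
      = ⟪(Ring.inverse Ψ.frameOp) g, Ψ.frameOp ((Ring.inverse Ψ.frameOp) f)⟫_ℂ := by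
        rw [frameOp_inverse]
    _ = ⟪g, (Ring.inverse Ψ.frameOp) f⟫_ℂ := by rw [← hS, frameOp_inverse]

/-- The frame reconstruction formula `f = ∑_k ⟨f, ψ̃_k⟩ ψ_k`. -/
theorem hasSum_dual (f : H) : HasSum (fun k => ⟪Ψ.dual k, f⟫_ℂ • Ψ.vec k) f := by
  have h := Ψ.hasSum_frameOp ((Ring.inverse Ψ.frameOp) f)
  rw [frameOp_inverse] at h
  simpa only [dual, inner_inverse_frameOp] using h

/-- The sequence of dual frame coefficients `C_{Ψ̃} f = (⟨f, ψ̃_k⟩)_k`. -/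
def dualCoeff : H →ₗ[ℂ] PreLp (fun _ : K => ℂ) where
  toFun f := fun k => ⟪Ψ.dual k, f⟫_ℂ
  map_add' f g := by
    funext k
    exact inner_add_right _ _ _
  map_smul' c f := by
    funext k
    exact inner_smul_right _ _ _

/-- The subspace `H⁰⁰` of finite linear combinations of the frame vectors. -/
def finSpan : Submodule ℂ H := Submodule.span ℂ (Set.range Ψ.vec)

end HilbertFrame

/-! ## Coorbit spaces

An element of the coorbit space `H^p_m` is represented by the sequence of its dual frame
coefficients `(⟨f, ψ̃_k⟩)_k`, and `f ∈ H⁰⁰` is identified with `C_{Ψ̃} f`. The norm of `H^p_m` is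
then the norm of `ℓ^p_m`. -/

section Coorbit

variable {K : Type u} {H : Type v} [NormedAddCommGroup H] [InnerProductSpace ℂ H]
  [CompleteSpace H]

/-- The image in `ℓ^p_m` of `H⁰⁰` under the isometric map `f ↦ C_{Ψ̃} f`. -/
def finCoorbit (Ψ : HilbertFrame K H) (p : ℝ≥0∞) (m : PosWeight K) :
    Submodule ℂ (WeightedLp m p) :=
  (Ψ.finSpan.map Ψ.dualCoeff).comap (WeightedLp m p).subtype

/-- The weak-`*` completion of `H⁰⁰`, used for `p = ∞`: an element is given by a sequence `(f_n)`
in `H⁰⁰` that is bounded in the norm `‖C_{Ψ̃} f‖_{ℓ^∞_m}` and for which `⟨f_n, ψ̃_k⟩` converges for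
every `k`; two sequences are identified if these limits coincide. -/
def weakStarCoorbit (Ψ : HilbertFrame K H) (p : ℝ≥0∞) (m : PosWeight K) :
    Submodule ℂ (WeightedLp m p) where
  carrier := {c | ∃ f : ℕ → H, (∀ n, f n ∈ Ψ.finSpan) ∧
    (∃ B : ℝ, ∀ n k, m k * ‖⟪Ψ.dual k, f n⟫_ℂ‖ ≤ B) ∧
    ∀ k, Filter.Tendsto (fun n => ⟪Ψ.dual k, f n⟫_ℂ) Filter.atTop (nhds (c.1 k))}
  zero_mem' := by
    refine ⟨fun _ => 0, fun _ => Submodule.zero_mem _, ⟨0, fun n k => by simp⟩, fun k => ?_⟩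
    simp only [inner_zero_right]
    exact tendsto_const_nhds
  add_mem' := by
    rintro c d ⟨f, hf, ⟨B, hB⟩, hfc⟩ ⟨g, hg, ⟨B', hB'⟩, hgd⟩
    refine ⟨fun n => f n + g n, fun n => Submodule.add_mem _ (hf n) (hg n),
      ⟨B + B', fun n k => ?_⟩, fun k => ?_⟩
    · rw [inner_add_right]
      calc m k * ‖⟪Ψ.dual k, f n⟫_ℂ + ⟪Ψ.dual k, g n⟫_ℂ‖
          ≤ m k * (‖⟪Ψ.dual k, f n⟫_ℂ‖ + ‖⟪Ψ.dual k, g n⟫_ℂ‖) :=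
            mul_le_mul_of_nonneg_left (norm_add_le _ _) (m.pos k).le
        _ ≤ B + B' := by rw [mul_add]; exact add_le_add (hB n k) (hB' n k)
    · simp only [inner_add_right]
      exact (hfc k).add (hgd k)
  smul_mem' := by
    rintro a c ⟨f, hf, ⟨B, hB⟩, hfc⟩
    refine ⟨fun n => a • f n, fun n => Submodule.smul_mem _ a (hf n),
      ⟨‖a‖ * B, fun n k => ?_⟩, fun k => ?_⟩
    · rw [inner_smul_right, norm_mul, mul_left_comm]
      exact mul_le_mul_of_nonneg_left (hB n k) (norm_nonneg a)
    · simp only [inner_smul_right]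
      exact (hfc k).const_mul a

open scoped Classical in
/-- The coorbit space `H^p_m`: for `p < ∞` the completion of `H⁰⁰` in the norm
`‖C_{Ψ̃} f‖_{ℓ^p_m}`, that is, the closure of its isometric image in the Banach space `ℓ^p_m`; for
`p = ∞` the weak-`*` completion. -/
def CoorbitSpace (Ψ : HilbertFrame K H) (p : ℝ≥0∞) [Fact (1 ≤ p)] (m : PosWeight K) :
    Submodule ℂ (WeightedLp m p) :=
  if p = ∞ then weakStarCoorbit Ψ p m else (finCoorbit Ψ p m).topologicalClosure

/-- The frame coefficient `⟨f, ψ_k⟩ = ∑_l ⟨f, ψ̃_l⟩ ⟨ψ_l, ψ_k⟩` of an element `f` that is given by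
its dual frame coefficients `c_l = ⟨f, ψ̃_l⟩`. -/
def frameCoeff (Ψ : HilbertFrame K H) (c : PreLp (fun _ : K => ℂ)) (k : K) : ℂ :=
  ∑' l, c l * ⟪Ψ.vec k, Ψ.vec l⟫_ℂ

/-- On the Hilbert space `frameCoeff` is the usual frame coefficient `⟨f, ψ_k⟩`. -/
theorem frameCoeff_dualCoeff (Ψ : HilbertFrame K H) (f : H) (k : K) :
    frameCoeff Ψ (Ψ.dualCoeff f) k = ⟪Ψ.vec k, f⟫_ℂ := by
  have h := (Ψ.hasSum_dual f).mapL (innerSL ℂ (Ψ.vec k))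
  simp only [innerSL_apply_apply, inner_smul_right] at h
  exact h.tsum_eq

/-- The duality `⟨f, g⟩ = ∑_k ⟨f, ψ̃_k⟩ conj ⟨g, ψ_k⟩` between `H^p_m` and `H^{p'}_{1/m}`, where `f`
and `g` are given by their dual frame coefficients. -/
def coorbitPairing (Ψ : HilbertFrame K H) (c d : PreLp (fun _ : K => ℂ)) : ℂ :=
  ∑' k, c k * conj (frameCoeff Ψ d k)

/-- The map `T : H^p_m → H^p_w` is the frame multiplier `f ↦ ∑_k μ_k ⟨f, ψ_k⟩ ψ_k`.

The first part says that the frame vectors `ψ_k` (as sequences, `C_{Ψ̃} ψ_k`) lie in `H^p_w`. Then,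
for every `f ∈ H^p_m`, the series defining `⟨f, ψ_k⟩` converge, and `T f` is the unconditional sum
of `μ_k ⟨f, ψ_k⟩ ψ_k`, in the norm of `H^p_w` for `p < ∞` and in the weak-`*` sense, tested against
`H^1_{1/w}`, for `p = ∞`. -/
def IsFrameMultiplier (Ψ : HilbertFrame K H) (μ : PosWeight K) {p : ℝ≥0∞} [Fact (1 ≤ p)]
    {m w : PosWeight K} (T : CoorbitSpace Ψ p m → CoorbitSpace Ψ p w) : Prop :=
  ∃ e : K → CoorbitSpace Ψ p w, (∀ k, (e k).1.1 = Ψ.dualCoeff (Ψ.vec k)) ∧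
    ∀ f : CoorbitSpace Ψ p m,
      (∀ k, Summable fun l => f.1.1 l * ⟪Ψ.vec k, Ψ.vec l⟫_ℂ) ∧
      (p ≠ ∞ → HasSum (fun k => ((μ k : ℂ) * frameCoeff Ψ f.1.1 k) • e k) (T f)) ∧
      (p = ∞ → ∀ g : CoorbitSpace Ψ 1 w⁻¹,
        (Summable fun k => (T f).1.1 k * conj (frameCoeff Ψ g.1.1 k)) ∧
        HasSum (fun k => (μ k : ℂ) * frameCoeff Ψ f.1.1 k * coorbitPairing Ψ (e k).1.1 g.1.1)
          (coorbitPairing Ψ (T f).1.1 g.1.1))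

end Coorbit

end

noncomputable section

universe u v

/-! ### Spectral radius estimates and an inverse square root by power series -/

section BanachAlgebra

/-! Let C be the analysis operator, G = C C* the Gram matrix on ℓ², and P the orthogonal projection
onto the range of C. If P lies in the algebra, it acts on every ℓ^p_w with w admissible, and the
coorbit space is exactly its fixed space there (`mem_coorbitSpace_iff`), hence complete. In these
coordinates M_μ is P diag(μ) G. Since G P = G, the composite M_{1/μ} M_μ is the single matrix X = P
N G of the algebra, where N = diag(1/μ) G diag(μ) is the adjoint of G^μ. An inverse of X relative to
P, found once in the algebra, therefore inverts the composite on all coorbit spaces at once. The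
same holds with μ and 1/μ exchanged, and bijectivity of both composites makes each factor bijective.
Three facts carry this.

P belongs to the algebra (`rangeProj_mem`): a Richardson polynomial e in G is 0 on the kernel of C*
and close to 1 on the range of C, and P = 1/2 + (e - 1/2)(1 - 4e(1-e))^{-1/2}. By inverse-closedness
e(1-e) has the same spectral radius in the algebra as on ℓ², so the binomial series converges in the
algebra. The algebra norm is not assumed to dominate the operator norm, but it does, up to the
factor ‖1‖, on the bicommutant of the self-adjoint element G, where all elements are normal; so both
limits agree.

Conjugation by √μ turns X into Q V* V, with V = diag(√μ) G diag(1/√μ) and Q the conjugate of P. The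
operator V* is bounded below on the range of V, so Z = Q - t Q V* V has exponentially decaying
powers on ℓ² for a small t > 0 (`exists_inverse_rangeProj_mul`).

This decay must be carried back to Y = P - tX, although √μ itself need not be admissible. Norms of
weight conjugates are log-convex in the exponent of the weight; the exponents -1, 0, 1/2 give ‖Y‖³ ≤
‖Z‖² ‖X'‖, where X' is the conjugate of Y by 1/μ. Applied to powers, together with r(X') ≤ r(Y) from
inverse-closedness, this yields r(Y) < 1 (`spectralRadius_lt_one_of_isWeightConj_sqrt`). Then 1 - Y
is invertible in the algebra and equals tX on the range of P. -/

theorem exists_norm_pow_le_of_spectralRadius_lt {B : Type*} [NormedRing B] [NormedAlgebra ℂ B]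
    [CompleteSpace B] (a : B) {r : ℝ} (h : spectralRadius ℂ a < ENNReal.ofReal r) :
    ∃ M : ℝ, 0 ≤ M ∧ ∀ n, ‖a ^ n‖ ≤ M * r ^ n := by
  have hr : 0 < r := ENNReal.ofReal_pos.1 (bot_le.trans_lt h)
  have h1 := (spectrum.pow_norm_pow_one_div_tendsto_nhds_spectralRadius a).eventually
    (gt_mem_nhds h)
  obtain ⟨N, hN⟩ := Filter.eventually_atTop.1 h1
  -- The finite sum absorbs the exponents before Gelfand's formula takes effect; the summand 1
  -- covers the rest.
  refine ⟨1 + ∑ n ∈ Finset.range (N + 1), ‖a ^ n‖ / r ^ n, by positivity, fun n => ?_⟩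
  by_cases hn : n < N + 1
  · have h2 : ‖a ^ n‖ / r ^ n ≤ ∑ n ∈ Finset.range (N + 1), ‖a ^ n‖ / r ^ n :=
      Finset.single_le_sum (f := fun n => ‖a ^ n‖ / r ^ n) (fun i _ => by positivity)
        (Finset.mem_range.2 hn)
    calc ‖a ^ n‖ = ‖a ^ n‖ / r ^ n * r ^ n := by field_simp
      _ ≤ _ := by gcongr; linarith
  · have h2 := hN n (by omega)
    have hn0 : (n : ℝ) ≠ 0 := by norm_cast; omega
    have h3 : ‖a ^ n‖ ^ (1 / n : ℝ) ≤ r := (ENNReal.ofReal_lt_ofReal_iff hr).1 h2 |>.le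
    have h4 : ‖a ^ n‖ ≤ r ^ n := by
      calc ‖a ^ n‖ = (‖a ^ n‖ ^ (1 / n : ℝ)) ^ n := by
            rw [← Real.rpow_natCast, ← Real.rpow_mul (norm_nonneg _), one_div_mul_cancel hn0,
              Real.rpow_one]
        _ ≤ r ^ n := by gcongr
    have h5 : 0 ≤ ∑ n ∈ Finset.range (N + 1), ‖a ^ n‖ / r ^ n := by positivity
    nlinarith [pow_pos hr n]

theorem spectralRadius_le_of_norm_pow_le {B : Type*} [NormedRing B] [NormedAlgebra ℂ B]
    [CompleteSpace B] (a : B) {M q : ℝ} (hq : 0 ≤ q) (h : ∀ n, ‖a ^ n‖ ≤ M * q ^ n) :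
    spectralRadius ℂ a ≤ ENNReal.ofReal q := by
  have hM : 0 ≤ M := by simpa using (norm_nonneg _).trans (h 0)
  by_contra! hlt
  obtain ⟨s, hs1, hs2⟩ := ENNReal.lt_iff_exists_nnreal_btwn.1 hlt
  have hs : q < s := by
    rw [← ENNReal.ofReal_coe_nnreal, ENNReal.ofReal_lt_ofReal_iff'] at hs1
    exact hs1.1
  have hs0 : (0 : ℝ) < s := hq.trans_lt hs
  have h1 := (spectrum.pow_norm_pow_one_div_tendsto_nhds_spectralRadius a).eventually
    (lt_mem_nhds hs2)
  have h2 : Filter.Tendsto (fun n : ℕ => M * (q / s) ^ n) Filter.atTop (nhds (M * 0)) :=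
    (tendsto_pow_atTop_nhds_zero_of_lt_one (by positivity) ((div_lt_one hs0).2 hs)).const_mul M
  rw [mul_zero] at h2
  obtain ⟨n, hn1, hn2, hn3⟩ :=
    (h1.and ((h2.eventually (gt_mem_nhds one_pos)).and (Filter.eventually_ge_atTop 1))).exists
  have hn0 : (n : ℝ) ≠ 0 := by norm_cast; omega
  rw [← ENNReal.ofReal_coe_nnreal, ENNReal.ofReal_lt_ofReal_iff'] at hn1
  have h3 : (s : ℝ) ^ n ≤ ‖a ^ n‖ := by
    calc (s : ℝ) ^ n ≤ (‖a ^ n‖ ^ (1 / n : ℝ)) ^ n := by gcongr; exact hn1.1.le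
      _ = ‖a ^ n‖ := by
          rw [← Real.rpow_natCast, ← Real.rpow_mul (norm_nonneg _), one_div_mul_cancel hn0,
            Real.rpow_one]
  have h4 := h3.trans (h n)
  rw [div_pow, ← mul_div_assoc, div_lt_one (by positivity)] at hn2
  linarith

/-- The factor ‖1‖ stays because the norm of an ARI-algebra is not assumed to be normalised. -/
theorem spectralRadius_le_norm_mul_norm_one {B : Type*} [NormedRing B] [NormedAlgebra ℂ B]
    [CompleteSpace B] (a : B) : spectralRadius ℂ a ≤ ENNReal.ofReal (‖a‖ * ‖(1 : B)‖) := by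
  have h := spectrum.spectralRadius_le_pow_nnnorm_pow_one_div ℂ a 0
  rw [ENNReal.ofReal_mul (norm_nonneg _)]
  simpa [ENNReal.ofReal, norm_toNNReal] using h

/-- Write a_n for the sum. Averaging the index i with its mirror image j turns the weight i into (i
+ j)/2, and the recurrence (i+1) C(i+1) = 2(2i+1) C(i) for central binomial coefficients then gives
(n+1) a_{n+1} = 4(n+1) a_n. -/
theorem sum_antidiagonal_centralBinom_mul (n : ℕ) :
    ∑ ij ∈ Finset.HasAntidiagonal.antidiagonal n, ij.1.centralBinom * ij.2.centralBinom = 4 ^ n := by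
  induction n with
  | zero => simp
  | succ n ih =>
    have h1 : ∑ ij ∈ Finset.HasAntidiagonal.antidiagonal (n + 1), ij.1 * (ij.1.centralBinom * ij.2.centralBinom)
        = ∑ ij ∈ Finset.HasAntidiagonal.antidiagonal n,
          (4 * ij.1 + 2) * (ij.1.centralBinom * ij.2.centralBinom) := by
      rw [Finset.Nat.sum_antidiagonal_succ]
      simp only [zero_mul, zero_add]
      refine Finset.sum_congr rfl fun ij _ => ?_
      rw [← mul_assoc, Nat.succ_mul_centralBinom_succ]
      ring
    have hswap : ∀ (N : ℕ) (f : ℕ → ℕ), ∑ ij ∈ Finset.HasAntidiagonal.antidiagonal N,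
        f ij.1 * (ij.1.centralBinom * ij.2.centralBinom) = ∑ ij ∈ Finset.HasAntidiagonal.antidiagonal N,
        f ij.2 * (ij.1.centralBinom * ij.2.centralBinom) := by
      intro N f
      rw [← Finset.Nat.sum_antidiagonal_swap]
      refine Finset.sum_congr rfl fun ij _ => ?_
      simp only [Prod.fst_swap, Prod.snd_swap]
      ring
    have h2 : (n + 1) * ∑ ij ∈ Finset.HasAntidiagonal.antidiagonal (n + 1), ij.1.centralBinom * ij.2.centralBinom
        = 2 * ∑ ij ∈ Finset.HasAntidiagonal.antidiagonal (n + 1),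
          ij.1 * (ij.1.centralBinom * ij.2.centralBinom) := by
      rw [two_mul]
      nth_rewrite 2 [hswap (n + 1) (fun i => i)]
      rw [← Finset.sum_add_distrib, Finset.mul_sum]
      refine Finset.sum_congr rfl fun ij hij => ?_
      rw [← Finset.HasAntidiagonal.mem_antidiagonal.1 hij]
      ring
    have h3 : 2 * ∑ ij ∈ Finset.HasAntidiagonal.antidiagonal n,
          (4 * ij.1 + 2) * (ij.1.centralBinom * ij.2.centralBinom)
        = (n + 1) * (4 * ∑ ij ∈ Finset.HasAntidiagonal.antidiagonal n,
          ij.1.centralBinom * ij.2.centralBinom) := by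
      rw [two_mul]
      nth_rewrite 2 [hswap n (fun i => 4 * i + 2)]
      rw [← Finset.sum_add_distrib, Finset.mul_sum, Finset.mul_sum]
      refine Finset.sum_congr rfl fun ij hij => ?_
      rw [← Finset.HasAntidiagonal.mem_antidiagonal.1 hij]
      ring
    have h4 := h2.trans ((congrArg (2 * ·) h1).trans h3)
    rw [ih] at h4
    have h5 := Nat.eq_of_mul_eq_mul_left (Nat.succ_pos n) h4
    rw [h5]; ring

theorem norm_centralBinom_smul_pow_le {B : Type*} [NormedRing B] [NormedAlgebra ℂ B] {u : B}
    {M r : ℝ} (h : ∀ n, ‖u ^ n‖ ≤ M * r ^ n) (n : ℕ) :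
    ‖(n.centralBinom : ℂ) • u ^ n‖ ≤ M * (4 * r) ^ n := by
  rw [norm_smul, Complex.norm_natCast, mul_pow]
  calc (n.centralBinom : ℝ) * ‖u ^ n‖ ≤ 4 ^ n * (M * r ^ n) := by
        gcongr
        · exact_mod_cast n.centralBinom_le_four_pow
        · exact h n
    _ = _ := by ring

theorem summable_norm_centralBinom_smul_pow {B : Type*} [NormedRing B] [NormedAlgebra ℂ B] {u : B}
    {M r : ℝ} (hr0 : 0 ≤ r) (hr : 4 * r < 1) (h : ∀ n, ‖u ^ n‖ ≤ M * r ^ n) :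
    Summable fun n : ℕ => ‖(n.centralBinom : ℂ) • u ^ n‖ :=
  Summable.of_nonneg_of_le (fun _ => norm_nonneg _) (norm_centralBinom_smul_pow_le h)
    ((summable_geometric_of_lt_one (by positivity) hr).mul_left M)

/-- The series `∑ binom(2n, n) uⁿ` is an inverse square root of `1 - 4u`. -/
theorem tsum_centralBinom_smul_pow_sq {B : Type*} [NormedRing B] [NormedAlgebra ℂ B]
    [CompleteSpace B] {u : B} (hu : ‖u‖ < 1 / 4)
    (hs : Summable fun n : ℕ => ‖(n.centralBinom : ℂ) • u ^ n‖) :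
    (1 - 4 * u) * ((∑' n : ℕ, (n.centralBinom : ℂ) • u ^ n) *
      ∑' n : ℕ, (n.centralBinom : ℂ) • u ^ n) = 1 := by
  rw [tsum_mul_tsum_eq_tsum_sum_antidiagonal_of_summable_norm hs hs]
  have h1 : ∀ n : ℕ, ∑ kl ∈ Finset.HasAntidiagonal.antidiagonal n,
      ((kl.1.centralBinom : ℂ) • u ^ kl.1) * ((kl.2.centralBinom : ℂ) • u ^ kl.2)
      = (4 * u) ^ n := by
    intro n
    have h2 : (4 : B) * u = (4 : ℂ) • u := by
      rw [Algebra.smul_def, map_ofNat]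
    rw [h2, smul_pow]
    have h3 := congrArg (Nat.cast (R := ℂ)) (sum_antidiagonal_centralBinom_mul n)
    push_cast at h3
    rw [← h3, Finset.sum_smul]
    refine Finset.sum_congr rfl fun kl hkl => ?_
    rw [smul_mul_smul_comm, ← pow_add, Finset.HasAntidiagonal.mem_antidiagonal.1 hkl]
  simp only [h1]
  refine mul_neg_geom_series _ ?_
  have h4 : (4 : B) * u = (4 : ℂ) • u := by
    rw [Algebra.smul_def, map_ofNat]
  rw [h4]
  refine (norm_smul_le _ _).trans_lt ?_
  rw [Complex.norm_ofNat]
  linarith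

theorem eq_zero_of_isIdempotentElem_of_norm_lt_one {B : Type*} [NormedRing B] {h : B}
    (hh : h * h = h) (hn : ‖h‖ < 1) : h = 0 := by
  by_contra h0
  have h1 : 0 < ‖h‖ := norm_pos_iff.2 h0
  have h2 := norm_mul_le h h
  rw [hh] at h2
  nlinarith

/-- If `e` is close to `1`, then the idempotent `1/2 + (e - 1/2)(1 - 4e(1-e))^{-1/2}` is `1`. -/
theorem half_add_mul_tsum_centralBinom_eq_one {B : Type*} [NormedRing B] [NormedAlgebra ℂ B]
    [CompleteSpace B] (h1 : ‖(1 : B)‖ ≤ 1) {e : B} (he : ‖1 - e‖ ≤ 1 / 32) :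
    (1 / 2 : ℂ) • (1 : B) + (e - (1 / 2 : ℂ) • 1) *
      ∑' n : ℕ, (n.centralBinom : ℂ) • (e * (1 - e)) ^ n = 1 := by
  set u := e * (1 - e) with hu
  set x := 1 - e with hx
  have hex : e = 1 - x := by rw [hx]; abel
  have hu1 : ‖u‖ ≤ 33 / 1024 := by
    calc ‖u‖ ≤ ‖e‖ * ‖x‖ := norm_mul_le _ _
      _ ≤ (1 + 1 / 32) * (1 / 32) := by
          gcongr
          rw [hex]
          exact (norm_sub_le _ _).trans (add_le_add h1 he)
      _ = _ := by norm_num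
  have hpow : ∀ n, ‖u ^ n‖ ≤ 1 * (33 / 1024 : ℝ) ^ n := by
    intro n
    rw [one_mul]
    rcases n with _ | n
    · simpa using h1
    · exact (norm_pow_le' u (Nat.succ_pos n)).trans (by gcongr)
  have hs := summable_norm_centralBinom_smul_pow (by norm_num) (by norm_num) hpow
  set S := ∑' n : ℕ, (n.centralBinom : ℂ) • u ^ n with hS
  have hsq : (1 - 4 * u) * (S * S) = 1 := tsum_centralBinom_smul_pow_sq (by linarith) hs
  have hcomm : Commute e S := by
    refine Commute.tsum_right _ fun n => ?_
    refine Commute.smul_right (Commute.pow_right ?_ n) _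
    rw [hu]
    exact (Commute.refl e).mul_right ((Commute.one_right e).sub_right (Commute.refl e))
  have hS1 : ‖S - 1‖ ≤ 1 / 6 := by
    have h2 : S = 1 + ∑' n : ℕ, ((n + 1).centralBinom : ℂ) • u ^ (n + 1) := by
      rw [hS, hs.of_norm.tsum_eq_zero_add]
      simp
    rw [h2, add_sub_cancel_left]
    have h3 : ∀ n : ℕ, ‖((n + 1).centralBinom : ℂ) • u ^ (n + 1)‖
        ≤ (33 / 256) * (33 / 256 : ℝ) ^ n := by
      intro n
      refine (norm_centralBinom_smul_pow_le hpow (n + 1)).trans (le_of_eq ?_)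
      rw [pow_succ]; norm_num; ring
    have h4 := (hasSum_geometric_of_lt_one (r := 33 / 256) (by norm_num) (by norm_num)).mul_left
      (33 / 256 : ℝ)
    refine (tsum_of_norm_bounded h4 h3).trans ?_
    norm_num
  -- Since z² = (2e-1)² = 1 - 4u, the element zS squares to 1, so h = (1 - zS)/2 is idempotent. It
  -- has norm below 1 and therefore vanishes.
  set z := e + e - 1 with hz
  have hz2 : z * z = 1 - 4 * u := by rw [hz, hu, hx]; noncomm_ring
  have hzS : Commute z S := (hcomm.add_left hcomm).sub_left (Commute.one_left _)
  have hF : (1 / 2 : ℂ) • (1 : B) + (e - (1 / 2 : ℂ) • 1) * S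
      = 1 - (1 / 2 : ℂ) • (1 - z * S) := by
    have h5 : e - (1 / 2 : ℂ) • (1 : B) = (1 / 2 : ℂ) • z := by
      rw [hz, smul_sub, smul_add, ← add_smul]; norm_num
    rw [h5, smul_mul_assoc, smul_sub]
    have h6 : (1 : B) = (1 / 2 : ℂ) • (1 : B) + (1 / 2 : ℂ) • (1 : B) := by
      rw [← add_smul]; norm_num
    nth_rewrite 2 [h6]
    abel
  have hzz : (z * S) * (z * S) = 1 := by
    rw [← hsq, ← hz2]
    calc z * S * (z * S) = z * (S * z) * S := by noncomm_ring
      _ = z * (z * S) * S := by rw [hzS.eq]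
      _ = _ := by noncomm_ring
  rw [hF]
  have h0 : (1 / 2 : ℂ) • (1 - z * S) = 0 := by
    refine eq_zero_of_isIdempotentElem_of_norm_lt_one ?_ ?_
    · rw [smul_mul_smul_comm]
      have h7 : (1 - z * S) * (1 - z * S) = (2 : ℂ) • (1 - z * S) := by
        rw [two_smul, sub_mul, mul_sub, mul_sub, hzz]; noncomm_ring
      rw [h7, smul_smul]; norm_num
    · have h8 : 1 - z * S = (x + x) - z * (S - 1) := by rw [hz, hx]; noncomm_ring
      have hzn : ‖z‖ ≤ 1 + 1 / 16 := by
        have h9 : z = 1 - (x + x) := by rw [hz, hx]; abel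
        rw [h9]
        refine (norm_sub_le _ _).trans ?_
        have := norm_add_le x x
        linarith
      have h10 : ‖1 - z * S‖ ≤ 1 := by
        rw [h8]
        refine (norm_sub_le _ _).trans ?_
        have h11 := norm_add_le x x
        have h12 : ‖z * (S - 1)‖ ≤ (1 + 1 / 16) * (1 / 6) :=
          (norm_mul_le _ _).trans (by gcongr)
        linarith
      refine (norm_smul_le _ _).trans_lt ?_
      norm_num
      linarith
  rw [h0, sub_zero]

end BanachAlgebra

/-! ### A contraction estimate -/

section Hilbert

/-- One step of the Richardson iteration for the positive operator `V V*`. -/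
theorem norm_sq_sub_smul_comp_adjoint_le {E F : Type*} [NormedAddCommGroup E]
    [InnerProductSpace ℂ E] [CompleteSpace E] [NormedAddCommGroup F] [InnerProductSpace ℂ F]
    [CompleteSpace F] (V : E →L[ℂ] F) {t c : ℝ} (ht : 0 ≤ t) (htV : t * ‖V‖ ^ 2 ≤ 1)
    {y : F} (hc : c * ‖y‖ ^ 2 ≤ ‖V.adjoint y‖ ^ 2) :
    ‖y - (t : ℂ) • V (V.adjoint y)‖ ^ 2 ≤ (1 - t * c) * ‖y‖ ^ 2 := by
  have h1 : RCLike.re ⟪y, (t : ℂ) • V (V.adjoint y)⟫_ℂ = t * ‖V.adjoint y‖ ^ 2 := by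
    rw [inner_smul_right, ← ContinuousLinearMap.adjoint_inner_left, inner_self_eq_norm_sq_to_K]
    norm_cast
    exact Complex.re_ofReal_mul t (‖V.adjoint y‖ ^ 2 : ℝ)
  rw [@norm_sub_sq ℂ, h1, norm_smul, mul_pow]
  have h2 : ‖V (V.adjoint y)‖ ^ 2 ≤ ‖V‖ ^ 2 * ‖V.adjoint y‖ ^ 2 := by
    rw [← mul_pow]; gcongr; exact V.le_opNorm _
  have h3 : ‖(t : ℂ)‖ = t := by simp [abs_of_nonneg ht]
  rw [h3]
  have h4 : t ^ 2 * ‖V (V.adjoint y)‖ ^ 2 ≤ t * ‖V.adjoint y‖ ^ 2 := by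
    calc t ^ 2 * ‖V (V.adjoint y)‖ ^ 2 ≤ t ^ 2 * (‖V‖ ^ 2 * ‖V.adjoint y‖ ^ 2) := by gcongr
      _ = t * (t * ‖V‖ ^ 2) * ‖V.adjoint y‖ ^ 2 := by ring
      _ ≤ t * 1 * ‖V.adjoint y‖ ^ 2 := by gcongr
      _ = _ := by ring
  have h5 : t * (c * ‖y‖ ^ 2) ≤ t * ‖V.adjoint y‖ ^ 2 := by gcongr
  linarith

end Hilbert

/-! ### Matrices of operators on ℓ², conjugation by weights, interpolation -/

section OpMatrix

variable {K : Type u}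

open scoped Classical in
/-- The canonical unit vector `e_k` of `ℓ²(K)`. -/
def unitVec (k : K) : lp (fun _ : K => ℂ) 2 := lp.single 2 k 1

theorem opMatrix_apply (T : lp (fun _ : K => ℂ) 2 →L[ℂ] lp (fun _ : K => ℂ) 2) (k l : K) :
    opMatrix T k l = T (unitVec l) k := rfl

open scoped Classical in
theorem unitVec_apply (k l : K) : unitVec k l = if l = k then 1 else 0 := by
  simp [unitVec, Pi.single_apply]

theorem hasSum_unitVec (x : lp (fun _ : K => ℂ) 2) : HasSum (fun k => x k • unitVec k) x := by
  classical
  have h := lp.hasSum_single (p := 2) (by norm_num) x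
  convert h using 2 with k
  ext j
  simp [unitVec_apply, Pi.single_apply]

theorem hasSum_opMatrix_mul (T : lp (fun _ : K => ℂ) 2 →L[ℂ] lp (fun _ : K => ℂ) 2)
    (x : lp (fun _ : K => ℂ) 2) (k : K) : HasSum (fun l => opMatrix T k l * x l) (T x k) := by
  have h := ((hasSum_unitVec x).mapL T).mapL (lp.evalCLM ℂ (fun _ : K => ℂ) 2 k)
  simpa [opMatrix_apply, lp.evalCLM, mul_comm] using h

theorem opMatrix_injective : Function.Injective (opMatrix (K := K)) := by
  intro S T h
  refine ContinuousLinearMap.ext fun x => lp.ext (funext fun k => ?_)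
  have h1 := hasSum_opMatrix_mul S x k
  rw [h] at h1
  exact h1.unique (hasSum_opMatrix_mul T x k)

theorem hasSum_opMatrix_comp (S T : lp (fun _ : K => ℂ) 2 →L[ℂ] lp (fun _ : K => ℂ) 2)
    (k l : K) : HasSum (fun j => opMatrix S k j * opMatrix T j l) (opMatrix (S * T) k l) :=
  hasSum_opMatrix_mul S (T (unitVec l)) k

theorem inner_unitVec_left (k : K) (x : lp (fun _ : K => ℂ) 2) : ⟪unitVec k, x⟫_ℂ = x k := by
  classical
  have h := lp.inner_single_left (𝕜 := ℂ) k (1 : ℂ) x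
  simpa [unitVec] using h

theorem opMatrix_adjoint (T : lp (fun _ : K => ℂ) 2 →L[ℂ] lp (fun _ : K => ℂ) 2) (k l : K) :
    opMatrix T.adjoint k l = conj (opMatrix T l k) := by
  rw [opMatrix_apply, opMatrix_apply, ← inner_unitVec_left, ← inner_unitVec_left,
    ContinuousLinearMap.adjoint_inner_right, inner_conj_symm]

theorem opMatrix_sub (S T : lp (fun _ : K => ℂ) 2 →L[ℂ] lp (fun _ : K => ℂ) 2) (k l : K) :
    opMatrix (S - T) k l = opMatrix S k l - opMatrix T k l := rfl

theorem opMatrix_smul (a : ℂ) (T : lp (fun _ : K => ℂ) 2 →L[ℂ] lp (fun _ : K => ℂ) 2)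
    (k l : K) : opMatrix (a • T) k l = a * opMatrix T k l := rfl

open scoped Classical in
theorem opMatrix_one (k l : K) : opMatrix (1 : lp (fun _ : K => ℂ) 2 →L[ℂ] _) k l
    = if k = l then 1 else 0 := unitVec_apply l k

/-- `T'` is the conjugated operator `diag(w) T diag(1/w)`, on the level of matrices. -/
def IsWeightConj (w : PosWeight K) (T T' : lp (fun _ : K => ℂ) 2 →L[ℂ] lp (fun _ : K => ℂ) 2) :
    Prop :=
  ∀ k l, opMatrix T' k l = w k * opMatrix T k l * (w l : ℂ)⁻¹

namespace IsWeightConj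

variable {w : PosWeight K} {S S' T T' : lp (fun _ : K => ℂ) 2 →L[ℂ] lp (fun _ : K => ℂ) 2}

theorem of_eq_conjDiag (h : opMatrix T' = conjDiag w (opMatrix T)) : IsWeightConj w T T' := by
  intro k l
  rw [h, conjDiag, Complex.ofReal_inv]

theorem weight_ne_zero (w : PosWeight K) (k : K) : (w k : ℂ) ≠ 0 :=
  Complex.ofReal_ne_zero.2 (w.pos k).ne'

theorem unique (h : IsWeightConj w T S) (h' : IsWeightConj w T T') : S = T' :=
  opMatrix_injective (funext fun k => funext fun l => (h k l).trans (h' k l).symm)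

theorem sub (h : IsWeightConj w S S') (h' : IsWeightConj w T T') :
    IsWeightConj w (S - T) (S' - T') := by
  intro k l
  rw [opMatrix_sub, opMatrix_sub, h, h']
  ring

theorem smul (a : ℂ) (h : IsWeightConj w T T') : IsWeightConj w (a • T) (a • T') := by
  intro k l
  rw [opMatrix_smul, opMatrix_smul, h]
  ring

theorem one : IsWeightConj w 1 1 := by
  classical
  intro k l
  rw [opMatrix_one]
  split_ifs with hkl
  · subst hkl
    rw [mul_one, mul_inv_cancel₀ (weight_ne_zero w k)]
  · simp

theorem mul (h : IsWeightConj w S S') (h' : IsWeightConj w T T') :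
    IsWeightConj w (S * T) (S' * T') := by
  intro k l
  have h1 := ((hasSum_opMatrix_comp S T k l).mul_left (w k : ℂ)).mul_right (w l : ℂ)⁻¹
  have h2 := hasSum_opMatrix_comp S' T' k l
  have h3 : ∀ j, opMatrix S' k j * opMatrix T' j l
      = w k * (opMatrix S k j * opMatrix T j l) * (w l : ℂ)⁻¹ := by
    intro j
    rw [h, h']
    have := weight_ne_zero w j
    field_simp
  simp only [h3] at h2
  exact h2.unique h1

theorem pow (h : IsWeightConj w T T') (n : ℕ) : IsWeightConj w (T ^ n) (T' ^ n) := by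
  induction n with
  | zero => simpa using one
  | succ n ih => rw [pow_succ, pow_succ]; exact ih.mul h

theorem symm (h : IsWeightConj w T T') : IsWeightConj w⁻¹ T' T := by
  intro k l
  have h1 : ∀ j, ((w⁻¹ : PosWeight K) j : ℂ) = (w j : ℂ)⁻¹ := fun j => Complex.ofReal_inv _
  rw [h, h1, h1]
  have := weight_ne_zero w k
  have := weight_ne_zero w l
  field_simp

theorem symm' (h : IsWeightConj w⁻¹ T T') : IsWeightConj w T' T := by
  intro k l
  have h1 : ∀ j, ((w⁻¹ : PosWeight K) j : ℂ) = (w j : ℂ)⁻¹ := fun j => Complex.ofReal_inv _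
  rw [h, h1, h1]
  have := weight_ne_zero w k
  have := weight_ne_zero w l
  field_simp

/-- Taking adjoints inverts the conjugating weight, so the roles of T and T' are exchanged. -/
theorem adjoint (h : IsWeightConj w T T') : IsWeightConj w T'.adjoint T.adjoint := by
  intro k l
  rw [opMatrix_adjoint, opMatrix_adjoint, h]
  have := weight_ne_zero w k
  have := weight_ne_zero w l
  simp only [map_mul, map_inv₀, Complex.conj_ofReal]
  field_simp

end IsWeightConj

/-- The finitely supported diagonal operator with entries `a k`, `k ∈ F`. -/
def finDiag (F : Finset K) (a : K → ℝ) : lp (fun _ : K => ℂ) 2 →L[ℂ] lp (fun _ : K => ℂ) 2 :=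
  ∑ k ∈ F, (lp.evalCLM ℂ (fun _ : K => ℂ) 2 k).smulRight ((a k : ℂ) • unitVec k)

open scoped Classical in
theorem finDiag_apply (F : Finset K) (a : K → ℝ) (x : lp (fun _ : K => ℂ) 2) (k : K) :
    finDiag F a x k = if k ∈ F then (a k : ℂ) * x k else 0 := by
  have h : ∀ G : Finset K, (∑ j ∈ G, (lp.evalCLM ℂ (fun _ : K => ℂ) 2 j).smulRight
      ((a j : ℂ) • unitVec j)) x k = ∑ j ∈ G, x j * (a j * unitVec j k) := by
    intro G
    induction G using Finset.induction_on with
    | empty => simp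
    | insert j G hj ih =>
      rw [Finset.sum_insert hj, Finset.sum_insert hj, ← ih]
      rfl
  rw [finDiag, h]
  simp [unitVec_apply, mul_comm]

theorem finDiag_mul (F : Finset K) (a b : K → ℝ) :
    finDiag F a * finDiag F b = finDiag F (fun k => a k * b k) := by
  refine ContinuousLinearMap.ext fun x => lp.ext (funext fun k => ?_)
  rw [mul_apply_eq_comp, finDiag_apply, finDiag_apply, finDiag_apply]
  split_ifs <;> simp [mul_assoc]

theorem opMatrix_finDiag_mul_mul (F : Finset K) (a b : K → ℝ)
    (T : lp (fun _ : K => ℂ) 2 →L[ℂ] lp (fun _ : K => ℂ) 2) {k l : K} (hk : k ∈ F) (hl : l ∈ F) :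
    opMatrix (finDiag F a * T * finDiag F b) k l = a k * opMatrix T k l * b l := by
  have h : finDiag F b (unitVec l) = (b l : ℂ) • unitVec l := by
    refine lp.ext (funext fun j => ?_)
    rw [finDiag_apply, lp.coeFn_smul, Pi.smul_apply, unitVec_apply]
    by_cases hj : j = l
    · subst hj; simp [hl]
    · simp [hj]
  rw [opMatrix_apply, mul_apply_eq_comp, mul_apply_eq_comp, h,
    finDiag_apply, if_pos hk, map_smul, lp.coeFn_smul, Pi.smul_apply, opMatrix_apply]
  simp; ring

theorem adjoint_finDiag (F : Finset K) (a : K → ℝ) : (finDiag F a).adjoint = finDiag F a := by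
  refine opMatrix_injective (funext fun k => funext fun l => ?_)
  rw [opMatrix_adjoint, opMatrix_apply, opMatrix_apply, finDiag_apply, finDiag_apply,
    unitVec_apply, unitVec_apply]
  by_cases hkl : k = l
  · subst hkl
    by_cases hk : k ∈ F <;> simp [hk]
  · simp [hkl, Ne.symm hkl]

theorem norm_finDiag_one_le (F : Finset K) : ‖finDiag F (fun _ => 1)‖ ≤ 1 := by
  refine ContinuousLinearMap.opNorm_le_bound _ zero_le_one fun x => ?_
  rw [one_mul]
  refine lp.norm_le_of_forall_sum_le (p := 2) (by norm_num) (norm_nonneg _) fun s => ?_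
  refine le_trans (Finset.sum_le_sum fun k _ => ?_)
    (lp.sum_rpow_le_norm_rpow (p := 2) (by norm_num) x s)
  rw [finDiag_apply]
  split_ifs
  · simp
  · simp only [norm_zero]
    rw [Real.zero_rpow (by norm_num)]
    positivity

/-- The spectra of ab and ba differ at most by 0, which does not affect the radius. -/
theorem spectralRadius_mul_comm {B : Type*} [NormedRing B] [NormedAlgebra ℂ B] (a b : B) :
    spectralRadius ℂ (a * b) = spectralRadius ℂ (b * a) := by
  have key : ∀ a b : B, spectralRadius ℂ (a * b) ≤ spectralRadius ℂ (b * a) := by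
    intro a b
    refine iSup₂_le fun z hz => ?_
    rcases eq_or_ne z 0 with rfl | h0
    · simp
    · have h1 : z ∈ spectrum ℂ (a * b) \ {0} := ⟨hz, h0⟩
      rw [spectrum.nonzero_mul_comm] at h1
      exact le_iSup₂ (f := fun (z : ℂ) (_ : z ∈ spectrum ℂ (b * a)) => (‖z‖₊ : ℝ≥0∞)) z h1.1
  exact le_antisymm (key a b) (key b a)

theorem PosWeight.sqrt_mul_sqrt (w : PosWeight K) (k : K) : w.sqrt k * w.sqrt k = w k :=
  Real.mul_self_sqrt (w.pos k).le

/-- For B = d T d', the C*-identity gives ‖B‖² = r(B*B). Moving one factor d' around cyclically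
leaves the spectral radius unchanged and turns B*B into T* d² T d'², where d² T d'² is a finite
section of T'. Finite sections are used because the weight may be unbounded. -/
theorem norm_sq_finDiag_sqrt_mul_mul_le {w : PosWeight K}
    {T T' : lp (fun _ : K => ℂ) 2 →L[ℂ] lp (fun _ : K => ℂ) 2} (h : IsWeightConj w T T')
    (F : Finset K) :
    ‖finDiag F w.sqrt * T * finDiag F (fun k => (w.sqrt k)⁻¹)‖ ^ 2 ≤ ‖T‖ * ‖T'‖ := by
  set d := finDiag F w.sqrt with hd
  set d' := finDiag F (fun k => (w.sqrt k)⁻¹) with hd'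
  set E := finDiag F (fun _ => 1) with hE
  have h1 : d * d * T * (d' * d') = E * T' * E := by
    rw [hd, hd', finDiag_mul, finDiag_mul]
    refine opMatrix_injective (funext fun k => funext fun l => ?_)
    by_cases hk : k ∈ F
    · by_cases hl : l ∈ F
      · rw [opMatrix_finDiag_mul_mul F _ _ _ hk hl, opMatrix_finDiag_mul_mul F _ _ _ hk hl,
          h k l, w.sqrt_mul_sqrt, ← mul_inv, w.sqrt_mul_sqrt]
        simp
      · have h2 : ∀ a : K → ℝ, finDiag F a (unitVec l) = 0 := by
          intro a
          refine lp.ext (funext fun j => ?_)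
          rw [finDiag_apply, unitVec_apply]
          by_cases hj : j = l
          · subst hj; simp [hl]
          · simp [hj]
        simp only [opMatrix_apply, mul_apply_eq_comp, h2, hE, map_zero]
    · simp only [opMatrix_apply, mul_apply_eq_comp, finDiag_apply, if_neg hk, hE]
  have h3 : star (d * T * d') * (d * T * d') = d' * (star T * (d * (d * (T * d')))) := by
    have e1 : star d = d := adjoint_finDiag F _
    have e2 : star d' = d' := adjoint_finDiag F _
    rw [star_mul, star_mul, e1, e2]
    simp only [mul_assoc]
  have h4 : star T * (d * (d * (T * d'))) * d' = star T * (E * T' * E) := by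
    rw [← h1]; simp only [mul_assoc]
  rw [← CStarAlgebra.toReal_spectralRadius_star_mul_self_eq_norm_sq, h3, spectralRadius_mul_comm,
    h4]
  refine ENNReal.toReal_le_of_le_ofReal (by positivity)
    ((spectralRadius_le_norm_mul_norm_one _).trans (ENNReal.ofReal_le_ofReal ?_))
  have hE1 : ‖E‖ ≤ 1 := norm_finDiag_one_le F
  have h11 : ‖(1 : lp (fun _ : K => ℂ) 2 →L[ℂ] lp (fun _ : K => ℂ) 2)‖ ≤ 1 :=
    ContinuousLinearMap.norm_id_le
  calc ‖star T * (E * T' * E)‖ * ‖(1 : lp (fun _ : K => ℂ) 2 →L[ℂ] lp (fun _ : K => ℂ) 2)‖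
      ≤ ‖star T * (E * T' * E)‖ * 1 := by gcongr
    _ ≤ ‖star T‖ * ((‖E‖ * ‖T'‖) * ‖E‖) := by
        rw [mul_one]
        refine (norm_mul_le _ _).trans ?_
        gcongr
        refine (norm_mul_le _ _).trans ?_
        gcongr
        exact norm_mul_le _ _
    _ ≤ ‖T‖ * ((1 * ‖T'‖) * 1) := by
        have hT : ‖star T‖ = ‖T‖ := ContinuousLinearMap.adjoint.norm_map T
        rw [hT]
        gcongr
    _ = ‖T‖ * ‖T'‖ := by ring

/-- A matrix whose finite sections are uniformly bounded on `ℓ²` defines a bounded operator. -/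
theorem exists_opMatrix_eq_of_finite_sections (M : Matrix K K ℂ) {c : ℝ} (hc : 0 ≤ c)
    (h : ∀ F : Finset K, ∃ T : lp (fun _ : K => ℂ) 2 →L[ℂ] lp (fun _ : K => ℂ) 2,
      ‖T‖ ≤ c ∧ ∀ k ∈ F, ∀ l ∈ F, opMatrix T k l = M k l) :
    ∃ V : lp (fun _ : K => ℂ) 2 →L[ℂ] lp (fun _ : K => ℂ) 2, opMatrix V = M ∧ ‖V‖ ≤ c := by
  classical
  have hcol : ∀ l, Memℓp (fun k => M k l) 2 := by
    intro l
    refine memℓp_gen' (C := (c * ‖unitVec l‖) ^ (2 : ℝ)) fun s => ?_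
    obtain ⟨T, hT, hTM⟩ := h (insert l s)
    calc ∑ k ∈ s, ‖M k l‖ ^ (2 : ℝ≥0∞).toReal
        = ∑ k ∈ s, ‖T (unitVec l) k‖ ^ (2 : ℝ≥0∞).toReal := by
          refine Finset.sum_congr rfl fun k hk => ?_
          rw [← hTM k (Finset.mem_insert_of_mem hk) l (Finset.mem_insert_self l s)]
          rfl
      _ ≤ ‖T (unitVec l)‖ ^ (2 : ℝ≥0∞).toReal :=
          lp.sum_rpow_le_norm_rpow (by norm_num) _ s
      _ ≤ (c * ‖unitVec l‖) ^ (2 : ℝ) := by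
          norm_num
          gcongr
          exact T.le_of_opNorm_le hT _
  let col : K → lp (fun _ : K => ℂ) 2 := fun l => ⟨fun k => M k l, hcol l⟩
  let f : (K →₀ ℂ) →ₗ[ℂ] lp (fun _ : K => ℂ) 2 := Finsupp.linearCombination ℂ col
  let e : (K →₀ ℂ) →ₗ[ℂ] lp (fun _ : K => ℂ) 2 := Finsupp.linearCombination ℂ unitVec
  -- The operator is defined on finitely supported sequences, bounded there by testing on a section
  -- that contains the support, and extended by density.
  have hdense : DenseRange e := by
    intro x
    refine mem_closure_of_tendsto (hasSum_unitVec x) (Filter.Eventually.of_forall fun s => ?_)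
    refine ⟨∑ k ∈ s, Finsupp.single k (x k), ?_⟩
    simp [e]
  have hnorm : ∀ x, ‖f x‖ ≤ c * ‖e x‖ := by
    intro x
    refine lp.norm_le_of_forall_sum_le (p := 2) (by norm_num) (by positivity) fun s => ?_
    obtain ⟨T, hT, hTM⟩ := h (x.support ∪ s)
    have hfT : ∀ k ∈ s, f x k = T (e x) k := by
      intro k hk
      simp only [f, e, Finsupp.linearCombination_apply, Finsupp.sum, map_sum, map_smul]
      rw [lp.coeFn_sum, lp.coeFn_sum, Finset.sum_apply, Finset.sum_apply]
      refine Finset.sum_congr rfl fun l hl => ?_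
      rw [lp.coeFn_smul, lp.coeFn_smul, Pi.smul_apply, Pi.smul_apply, ← opMatrix_apply,
        hTM k (Finset.mem_union_right _ hk) l (Finset.mem_union_left _ hl)]
    calc ∑ k ∈ s, ‖f x k‖ ^ (2 : ℝ≥0∞).toReal
        = ∑ k ∈ s, ‖T (e x) k‖ ^ (2 : ℝ≥0∞).toReal :=
          Finset.sum_congr rfl fun k hk => by rw [hfT k hk]
      _ ≤ ‖T (e x)‖ ^ (2 : ℝ≥0∞).toReal := lp.sum_rpow_le_norm_rpow (by norm_num) _ s
      _ ≤ (c * ‖e x‖) ^ (2 : ℝ≥0∞).toReal := by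
          gcongr
          exact T.le_of_opNorm_le hT _
  refine ⟨f.extendOfNorm e, ?_, LinearMap.opNorm_extendOfNorm_le hdense hc hnorm⟩
  funext k l
  have h1 := LinearMap.extendOfNorm_eq hdense ⟨c, hnorm⟩ (Finsupp.single l 1)
  simp only [e, f, Finsupp.linearCombination_single, one_smul] at h1
  rw [opMatrix_apply]
  exact congrArg (fun y : lp (fun _ : K => ℂ) 2 => y k) h1

/-- Interpolation between `ℓ²` and `ℓ²_w`. -/
theorem IsWeightConj.exists_sqrt {w : PosWeight K}
    {T T' : lp (fun _ : K => ℂ) 2 →L[ℂ] lp (fun _ : K => ℂ) 2} (h : IsWeightConj w T T') :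
    ∃ V, IsWeightConj w.sqrt T V ∧ ‖V‖ ^ 2 ≤ ‖T‖ * ‖T'‖ := by
  obtain ⟨V, hV, hVn⟩ := exists_opMatrix_eq_of_finite_sections
    (fun k l => w.sqrt k * opMatrix T k l * (w.sqrt l : ℂ)⁻¹) (Real.sqrt_nonneg (‖T‖ * ‖T'‖))
    fun F => ⟨finDiag F w.sqrt * T * finDiag F (fun k => (w.sqrt k)⁻¹),
      Real.le_sqrt_of_sq_le (norm_sq_finDiag_sqrt_mul_mul_le h F), fun k hk l hl => by
        rw [opMatrix_finDiag_mul_mul F _ _ _ hk hl, Complex.ofReal_inv]⟩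
  refine ⟨V, fun k l => by rw [hV], ?_⟩
  calc ‖V‖ ^ 2 ≤ Real.sqrt (‖T‖ * ‖T'‖) ^ 2 := by gcongr
    _ = _ := Real.sq_sqrt (by positivity)

theorem IsWeightConj.norm_sq_le {w : PosWeight K}
    {T T' V : lp (fun _ : K => ℂ) 2 →L[ℂ] lp (fun _ : K => ℂ) 2} (h : IsWeightConj w T T')
    (hV : IsWeightConj w.sqrt T V) : ‖V‖ ^ 2 ≤ ‖T‖ * ‖T'‖ := by
  obtain ⟨V', h1, h2⟩ := h.exists_sqrt
  rwa [hV.unique h1]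

end OpMatrix

/-! ### Spectral invariance, and comparison of the algebra norm with the operator norm -/

namespace ARIAlgebra

variable {K : Type u} (A : ARIAlgebra K)

/-- The algebra of an ARI-algebra, to be endowed with its own Banach algebra norm. -/
def Carrier : Type u := A.alg

instance : Ring A.Carrier := inferInstanceAs (Ring A.alg)

instance : Algebra ℂ A.Carrier := inferInstanceAs (Algebra ℂ A.alg)

instance : StarRing A.Carrier := inferInstanceAs (StarRing A.alg)

instance : NormedRing A.Carrier :=
  RingNorm.toNormedRing (R := A.Carrier) (A.algNorm.toRingNorm : RingNorm A.alg)

instance : NormedAlgebra ℂ A.Carrier where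
  norm_smul_le c a := (A.algNorm.smul' c (show A.alg from a)).le

instance : CompleteSpace A.Carrier := by
  refine Metric.complete_of_cauchySeq_tendsto fun a ha => ?_
  obtain ⟨b, hb⟩ := A.complete (fun i => (show A.alg from a i)) fun ε hε => by
    obtain ⟨N, hN⟩ := Metric.cauchySeq_iff.1 ha ε hε
    refine ⟨N, fun i hi j hj => ?_⟩
    have h := hN i hi j hj
    rwa [dist_eq_norm] at h
  refine ⟨b, tendsto_iff_norm_sub_tendsto_zero.2 hb⟩

/-- The inclusion of the algebra in the bounded operators on `ℓ²(K)`. -/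
def incl : A.Carrier →ₐ[ℂ] (lp (fun _ : K => ℂ) 2 →L[ℂ] lp (fun _ : K => ℂ) 2) :=
  A.alg.subtype.toAlgHom

theorem incl_star (a : A.Carrier) : A.incl (star a) = star (A.incl a) := rfl

theorem incl_injective : Function.Injective A.incl := Subtype.val_injective

theorem incl_mem (a : A.Carrier) : A.incl a ∈ A.alg := Subtype.property _

theorem isUnit_of_isUnit_incl {a : A.Carrier} (h : IsUnit (A.incl a)) : IsUnit a := by
  have h1 := A.inverse_closed _ (A.incl_mem a) h
  let b : A.Carrier := (⟨Ring.inverse (A.incl a), h1⟩ : A.alg)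
  have hab : a * b = 1 := A.incl_injective (by
    rw [map_mul, map_one]; exact Ring.mul_inverse_cancel _ h)
  have hba : b * a = 1 := A.incl_injective (by
    rw [map_mul, map_one]; exact Ring.inverse_mul_cancel _ h)
  exact ⟨⟨a, b, hab, hba⟩, rfl⟩

/-- This is inverse-closedness applied to z - a: the algebra and the bounded operators on ℓ² see the
same spectrum. -/
theorem spectrum_incl (a : A.Carrier) : spectrum ℂ (A.incl a) = spectrum ℂ a := by
  refine Set.Subset.antisymm (AlgHom.spectrum_apply_subset A.incl a) fun z hz hz' => hz ?_
  refine A.isUnit_of_isUnit_incl ?_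
  rw [map_sub, AlgHom.commutes]
  exact hz'

theorem spectralRadius_incl (a : A.Carrier) :
    spectralRadius ℂ (A.incl a) = spectralRadius ℂ a := by
  rw [spectralRadius, spectrum_incl, spectralRadius]

/-- On the bicommutant of a self-adjoint element the operator norm is dominated by the norm of
the algebra. -/
theorem norm_incl_le_of_mem_centralizer {g a : A.Carrier} (hg : star g = g)
    (ha : a ∈ Set.centralizer (Set.centralizer {g})) : ‖A.incl a‖ ≤ ‖a‖ * ‖(1 : A.Carrier)‖ := by
  have hga : a * g = g * a := (ha g (by simp [Set.mem_centralizer_iff])).symm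
  -- As g is self-adjoint, its commutant is closed under the involution; an element a of the
  -- bicommutant thus commutes with a*, so it is normal and its operator norm equals its spectral
  -- radius.
  have hsa : star a ∈ Set.centralizer {g} := by
    rw [Set.mem_centralizer_iff]
    rintro _ rfl
    have := congrArg star hga
    rw [star_mul, star_mul, hg] at this
    exact this
  have hn : IsStarNormal (A.incl a) := ⟨by
    rw [← incl_star, Commute, SemiconjBy, ← map_mul, ← map_mul, ha _ hsa]⟩
  have h1 := IsStarNormal.spectralRadius_eq_nnnorm (A.incl a)
  rw [spectralRadius_incl] at h1
  have h2 := spectralRadius_le_norm_mul_norm_one a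
  rw [h1, ← ENNReal.ofReal_coe_nnreal, coe_nnnorm, ENNReal.ofReal_le_ofReal_iff (by positivity)]
    at h2
  exact h2

/-- The bicommutant is closed in the algebra norm, so the differences between partial sums and the
limit lie in it, and there the algebra norm controls the operator norm. -/
theorem hasSum_incl_of_mem_centralizer {g : A.Carrier} (hg : star g = g) {a : ℕ → A.Carrier}
    {s : A.Carrier} (ha : ∀ n, a n ∈ Set.centralizer (Set.centralizer {g})) (hs : HasSum a s) :
    HasSum (fun n => A.incl (a n)) (A.incl s) := by
  have hfin : ∀ F : Finset ℕ, ∑ n ∈ F, a n ∈ Set.centralizer (Set.centralizer {g}) := fun F =>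
    (Subalgebra.centralizer ℂ (Set.centralizer {g})).sum_mem fun n _ => ha n
  have hsD : s ∈ Set.centralizer (Set.centralizer {g}) :=
    (Set.isClosed_centralizer _).mem_of_tendsto hs (Filter.Eventually.of_forall hfin)
  have hdiff : ∀ F : Finset ℕ, ∑ n ∈ F, a n - s ∈ Set.centralizer (Set.centralizer {g}) := fun F =>
    (Subalgebra.centralizer ℂ (Set.centralizer {g})).sub_mem (hfin F) hsD
  rw [HasSum, tendsto_iff_norm_sub_tendsto_zero]
  have h1 : Filter.Tendsto (fun F : Finset ℕ => ‖∑ n ∈ F, a n - s‖ * ‖(1 : A.Carrier)‖)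
      Filter.atTop (nhds (0 * ‖(1 : A.Carrier)‖)) :=
    (tendsto_iff_norm_sub_tendsto_zero.1 hs).mul_const _
  rw [zero_mul] at h1
  refine squeeze_zero (fun _ => norm_nonneg _) (fun F => ?_) h1
  rw [← map_sum, ← map_sub]
  exact A.norm_incl_le_of_mem_centralizer hg (hdiff F)

end ARIAlgebra

/-! ### Gram operator, range projection and dual Gram operator -/

namespace HilbertFrame

variable {K : Type u} {H : Type v} [NormedAddCommGroup H] [InnerProductSpace ℂ H]
  [CompleteSpace H] (Ψ : HilbertFrame K H)

/-- The Gram matrix as an operator on `ℓ²(K)`. -/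
def gramOp : lp (fun _ : K => ℂ) 2 →L[ℂ] lp (fun _ : K => ℂ) 2 :=
  Ψ.analysis ∘L Ψ.analysis.adjoint

/-- The orthogonal projection of `ℓ²(K)` onto the range of the analysis operator. -/
def rangeProj : lp (fun _ : K => ℂ) 2 →L[ℂ] lp (fun _ : K => ℂ) 2 :=
  Ψ.analysis ∘L (Ring.inverse Ψ.frameOp) ∘L Ψ.analysis.adjoint

/-- The Gram matrix of the dual frame as an operator on `ℓ²(K)`. -/
def dualGramOp : lp (fun _ : K => ℂ) 2 →L[ℂ] lp (fun _ : K => ℂ) 2 :=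
  Ψ.analysis ∘L (Ring.inverse Ψ.frameOp) ∘L (Ring.inverse Ψ.frameOp) ∘L Ψ.analysis.adjoint

theorem adjoint_analysis_analysis (f : H) :
    Ψ.analysis.adjoint (Ψ.analysis f) = Ψ.frameOp f := rfl

theorem inverse_frameOp_frameOp (f : H) : (Ring.inverse Ψ.frameOp) (Ψ.frameOp f) = f :=
  congrArg (fun T : H →L[ℂ] H => T f) (Ring.inverse_mul_cancel Ψ.frameOp Ψ.isUnit_frameOp)

theorem gramOp_apply (x : lp (fun _ : K => ℂ) 2) :
    Ψ.gramOp x = Ψ.analysis (Ψ.analysis.adjoint x) := rfl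

theorem rangeProj_apply (x : lp (fun _ : K => ℂ) 2) : Ψ.rangeProj x
    = Ψ.analysis ((Ring.inverse Ψ.frameOp) (Ψ.analysis.adjoint x)) := rfl

theorem dualGramOp_apply (x : lp (fun _ : K => ℂ) 2) : Ψ.dualGramOp x
    = Ψ.analysis ((Ring.inverse Ψ.frameOp) ((Ring.inverse Ψ.frameOp) (Ψ.analysis.adjoint x))) :=
  rfl

theorem gramOp_mul_rangeProj : Ψ.gramOp * Ψ.rangeProj = Ψ.gramOp := by
  ext1 x
  simp only [mul_apply_eq_comp, gramOp_apply, rangeProj_apply, adjoint_analysis_analysis,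
    frameOp_inverse]

theorem rangeProj_mul_gramOp : Ψ.rangeProj * Ψ.gramOp = Ψ.gramOp := by
  ext1 x
  simp only [mul_apply_eq_comp, gramOp_apply, rangeProj_apply, adjoint_analysis_analysis,
    inverse_frameOp_frameOp]

theorem rangeProj_mul_rangeProj : Ψ.rangeProj * Ψ.rangeProj = Ψ.rangeProj := by
  ext1 x
  simp only [mul_apply_eq_comp, rangeProj_apply, adjoint_analysis_analysis,
    inverse_frameOp_frameOp]

theorem dualGramOp_mul_gramOp : Ψ.dualGramOp * Ψ.gramOp = Ψ.rangeProj := by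
  ext1 x
  simp only [mul_apply_eq_comp, gramOp_apply, rangeProj_apply, dualGramOp_apply,
    adjoint_analysis_analysis, inverse_frameOp_frameOp]

theorem gramOp_mul_dualGramOp : Ψ.gramOp * Ψ.dualGramOp = Ψ.rangeProj := by
  ext1 x
  simp only [mul_apply_eq_comp, gramOp_apply, rangeProj_apply, dualGramOp_apply,
    adjoint_analysis_analysis, frameOp_inverse]

theorem rangeProj_mul_dualGramOp : Ψ.rangeProj * Ψ.dualGramOp = Ψ.dualGramOp := by
  ext1 x
  simp only [mul_apply_eq_comp, rangeProj_apply, dualGramOp_apply,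
    adjoint_analysis_analysis, inverse_frameOp_frameOp]

theorem dualGramOp_mul_rangeProj : Ψ.dualGramOp * Ψ.rangeProj = Ψ.dualGramOp := by
  ext1 x
  simp only [mul_apply_eq_comp, rangeProj_apply, dualGramOp_apply,
    adjoint_analysis_analysis, frameOp_inverse]

theorem adjoint_gramOp : Ψ.gramOp.adjoint = Ψ.gramOp := by
  rw [gramOp, ContinuousLinearMap.adjoint_comp, ContinuousLinearMap.adjoint_adjoint]

theorem adjoint_analysis_unitVec (k : K) : Ψ.analysis.adjoint (unitVec k) = Ψ.vec k := by
  refine ext_inner_left ℂ fun g => ?_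
  rw [ContinuousLinearMap.adjoint_inner_right, ← inner_conj_symm, inner_unitVec_left,
    analysis_apply, inner_conj_symm]

theorem opMatrix_gramOp : opMatrix Ψ.gramOp = Ψ.gram := by
  funext k l
  rw [opMatrix_apply, gramOp_apply, adjoint_analysis_unitVec]
  rfl

theorem opMatrix_rangeProj (k l : K) : opMatrix Ψ.rangeProj k l = ⟪Ψ.dual k, Ψ.vec l⟫_ℂ := by
  rw [opMatrix_apply, rangeProj_apply, adjoint_analysis_unitVec, analysis_apply, dual,
    inner_inverse_frameOp]

theorem adjoint_rangeProj : Ψ.rangeProj.adjoint = Ψ.rangeProj := by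
  refine opMatrix_injective (funext fun k => funext fun l => ?_)
  rw [opMatrix_adjoint, opMatrix_rangeProj, opMatrix_rangeProj, inner_conj_symm, dual, dual,
    inner_inverse_frameOp]

/-- This is the Richardson step for the positive operator C* C, with lower frame bound a and t =
1/(‖C‖² + a). -/
theorem exists_norm_one_sub_smul_frameOp_le :
    ∃ t ρ : ℝ, 0 ≤ ρ ∧ ρ < 1 ∧ ‖(1 : H →L[ℂ] H) - (t : ℂ) • Ψ.frameOp‖ ≤ ρ := by
  obtain ⟨a, b, ha, -, h⟩ := Ψ.isFrame
  have hpos : 0 < ‖Ψ.analysis‖ ^ 2 + a := by positivity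
  set t := (‖Ψ.analysis‖ ^ 2 + a)⁻¹ with ht
  have ht0 : 0 < t := inv_pos.2 hpos
  have hta : t * a ≤ 1 := by
    rw [ht, inv_mul_le_iff₀ hpos]; nlinarith [sq_nonneg ‖Ψ.analysis‖]
  have htC : t * ‖Ψ.analysis‖ ^ 2 ≤ 1 := by
    rw [ht, inv_mul_le_iff₀ hpos]; linarith
  refine ⟨t, Real.sqrt (1 - t * a), Real.sqrt_nonneg _, ?_, ?_⟩
  · rw [Real.sqrt_lt' one_pos]
    nlinarith [mul_pos ht0 ha]
  · refine ContinuousLinearMap.opNorm_le_bound _ (Real.sqrt_nonneg _) fun y => ?_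
    refine (abs_le_of_sq_le_sq' ?_ (by positivity)).2
    rw [mul_pow, Real.sq_sqrt (by linarith)]
    have hV : ‖Ψ.analysis.adjoint‖ = ‖Ψ.analysis‖ := ContinuousLinearMap.adjoint.norm_map _
    have h1 := norm_sq_sub_smul_comp_adjoint_le Ψ.analysis.adjoint (t := t) (c := a) (y := y)
      ht0.le (by rw [hV]; exact htC) (by
        rw [ContinuousLinearMap.adjoint_adjoint]
        have h2 : ‖Ψ.analysis y‖ ^ 2 = _ := Ψ.norm_sq_analysisLin y
        rw [h2]
        exact (h y).2.1)
    rw [ContinuousLinearMap.adjoint_adjoint] at h1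
    exact h1

end HilbertFrame

/-! ### The range projection and the dual Gram matrix belong to the algebra -/

namespace HilbertFrame

variable {K : Type u} {H : Type v} [NormedAddCommGroup H] [InnerProductSpace ℂ H]
  (Ψ : HilbertFrame K H)

/-- The analysis operator intertwines `Y` on `H` and `X` on `ℓ²(K)`. -/
def Intertwines (X : lp (fun _ : K => ℂ) 2 →L[ℂ] lp (fun _ : K => ℂ) 2) (Y : H →L[ℂ] H) : Prop :=
  ∀ f, X (Ψ.analysis f) = Ψ.analysis (Y f)

namespace Intertwines

variable {Ψ} {X X' : lp (fun _ : K => ℂ) 2 →L[ℂ] lp (fun _ : K => ℂ) 2} {Y Y' : H →L[ℂ] H}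

theorem one : Ψ.Intertwines 1 1 := fun _ => rfl

theorem mul (h : Ψ.Intertwines X Y) (h' : Ψ.Intertwines X' Y') :
    Ψ.Intertwines (X * X') (Y * Y') := fun f => by
  rw [mul_apply_eq_comp, mul_apply_eq_comp, h', h]

theorem sub (h : Ψ.Intertwines X Y) (h' : Ψ.Intertwines X' Y') :
    Ψ.Intertwines (X - X') (Y - Y') := fun f => by
  rw [_root_.sub_apply, _root_.sub_apply, h, h', map_sub]

theorem add (h : Ψ.Intertwines X Y) (h' : Ψ.Intertwines X' Y') :
    Ψ.Intertwines (X + X') (Y + Y') := fun f => by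
  rw [_root_.add_apply, _root_.add_apply, h, h', map_add]

theorem smul (c : ℂ) (h : Ψ.Intertwines X Y) : Ψ.Intertwines (c • X) (c • Y) := fun f => by
  rw [_root_.smul_apply, _root_.smul_apply, h, map_smul]

theorem pow (h : Ψ.Intertwines X Y) (n : ℕ) : Ψ.Intertwines (X ^ n) (Y ^ n) := by
  induction n with
  | zero => exact one
  | succ n ih => rw [pow_succ, pow_succ]; exact ih.mul h

theorem hasSum {X : ℕ → lp (fun _ : K => ℂ) 2 →L[ℂ] lp (fun _ : K => ℂ) 2} {Y : ℕ → H →L[ℂ] H}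
    {S : lp (fun _ : K => ℂ) 2 →L[ℂ] lp (fun _ : K => ℂ) 2} {R : H →L[ℂ] H}
    (h : ∀ n, Ψ.Intertwines (X n) (Y n)) (hX : HasSum X S) (hY : HasSum Y R) :
    Ψ.Intertwines S R := fun f => by
  have h1 := hX.mapL (ContinuousLinearMap.apply ℂ _ (Ψ.analysis f))
  have h2 := (hY.mapL (ContinuousLinearMap.apply ℂ _ f)).mapL Ψ.analysis
  simp only [ContinuousLinearMap.apply_apply, (h _ _)] at h1 h2
  exact h1.unique h2

end Intertwines

variable [CompleteSpace H]

theorem adjoint_analysis_sub_rangeProj (y : lp (fun _ : K => ℂ) 2) :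
    Ψ.analysis.adjoint (y - Ψ.rangeProj y) = 0 := by
  rw [map_sub, rangeProj_apply, adjoint_analysis_analysis, frameOp_inverse, sub_self]

set_option maxHeartbeats 1000000 in
/-- The orthogonal projection onto the range of the analysis operator of a localized frame belongs
to the algebra. -/
theorem rangeProj_mem {A : ARIAlgebra K} (hG : Ψ.gramOp ∈ A.alg) : Ψ.rangeProj ∈ A.alg := by
  obtain ⟨t, ρ, hρ0, hρ1, hρ⟩ := Ψ.exists_norm_one_sub_smul_frameOp_le
  obtain ⟨N, hN⟩ := exists_pow_lt_of_lt_one (show (0 : ℝ) < 1 / 32 by norm_num) hρ1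
  have hN0 : 0 < N := by
    rcases Nat.eq_zero_or_pos N with rfl | h
    · norm_num at hN
    · exact h
  let g : A.Carrier := (⟨Ψ.gramOp, hG⟩ : A.alg)
  have hg : A.incl g = Ψ.gramOp := rfl
  have hgs : star g = g := A.incl_injective (by
    rw [A.incl_star, hg]; exact Ψ.adjoint_gramOp)
  -- The analysis operator intertwines x, e, w with their analogues on H, where xH is small. The
  -- exponent N makes ‖xH‖ ≤ 1/32, the bound required by `half_add_mul_tsum_centralBinom_eq_one`.
  set x : A.Carrier := (1 - (t : ℂ) • g) ^ N with hx
  set e : A.Carrier := 1 - x with he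
  set w : A.Carrier := e * (1 - e) with hw
  set xH : H →L[ℂ] H := (1 - (t : ℂ) • Ψ.frameOp) ^ N with hxH
  set eH : H →L[ℂ] H := 1 - xH with heH
  set wH : H →L[ℂ] H := eH * (1 - eH) with hwH
  have h1H : ‖(1 : H →L[ℂ] H)‖ ≤ 1 := ContinuousLinearMap.norm_id_le
  have hxHn : ‖xH‖ ≤ 1 / 32 := by
    refine (norm_pow_le' _ hN0).trans (le_trans ?_ hN.le)
    gcongr
  have heH1 : 1 - eH = xH := by rw [heH]; abel
  have he1 : 1 - e = x := by rw [he]; abel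
  have hwHn : ‖wH‖ ≤ 33 / 1024 := by
    calc ‖wH‖ ≤ ‖eH‖ * ‖1 - eH‖ := norm_mul_le _ _
      _ ≤ (1 + 1 / 32) * (1 / 32) := by
          rw [heH1]
          gcongr
          exact (norm_sub_le _ _).trans (add_le_add h1H hxHn)
      _ = _ := by norm_num
  have ig : Ψ.Intertwines (A.incl g) Ψ.frameOp := fun f => rfl
  have ie : Ψ.Intertwines (A.incl e) eH := by
    rw [he, hx, map_sub, map_one, map_pow, map_sub, map_one, map_smul]
    exact Intertwines.one.sub ((Intertwines.one.sub (ig.smul _)).pow N)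
  have iw : Ψ.Intertwines (A.incl w) wH := by
    rw [hw, map_mul, map_sub, map_one]
    exact ie.mul (Intertwines.one.sub ie)
  -- On the kernel of C* the Gram operator vanishes, so x acts there as 1, and both e and w as 0.
  have kx : ∀ z, Ψ.analysis.adjoint z = 0 → A.incl x z = z := by
    intro z hz
    have h1 : (1 - (t : ℂ) • Ψ.gramOp) z = z := by
      rw [_root_.sub_apply, _root_.smul_apply, gramOp_apply, hz]
      simp
    set T := 1 - (t : ℂ) • Ψ.gramOp with hT
    have h2 : ∀ n : ℕ, (T ^ n) z = z := by
      intro n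
      induction n with
      | zero => rfl
      | succ n ih => rw [pow_succ, mul_apply_eq_comp, h1, ih]
    rw [hx, map_pow, map_sub, map_one, map_smul, hg, h2]
  have ke : ∀ z, Ψ.analysis.adjoint z = 0 → A.incl e z = 0 := by
    intro z hz
    rw [he, map_sub, map_one, _root_.sub_apply, kx z hz]
    simp
  have kw : ∀ z, Ψ.analysis.adjoint z = 0 → A.incl w z = 0 := by
    intro z hz
    rw [hw, he1, map_mul, mul_apply_eq_comp, kx z hz, ke z hz]
  have hdec : ∀ y, y = Ψ.analysis ((Ring.inverse Ψ.frameOp) (Ψ.analysis.adjoint y))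
      + (y - Ψ.rangeProj y) := by
    intro y
    rw [rangeProj_apply]; abel
  set M : ℝ := 1 + ‖Ψ.analysis‖ * (‖Ring.inverse Ψ.frameOp‖ * ‖Ψ.analysis.adjoint‖) with hM
  -- Positive powers of w factor through H as C wH^n S⁻¹ C*; the summand 1 in M is for the zeroth
  -- power.
  have hwpow : ∀ n, ‖A.incl w ^ n‖ ≤ M * (33 / 1024 : ℝ) ^ n := by
    intro n
    have hM1 : 1 ≤ M := by
      have : 0 ≤ ‖Ψ.analysis‖ * (‖Ring.inverse Ψ.frameOp‖ * ‖Ψ.analysis.adjoint‖) := by positivity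
      linarith
    rcases n with _ | n
    · rw [pow_zero, pow_zero, mul_one]
      exact le_trans ContinuousLinearMap.norm_id_le hM1
    · have h1 : A.incl w ^ (n + 1)
          = Ψ.analysis ∘L (wH ^ (n + 1)) ∘L (Ring.inverse Ψ.frameOp) ∘L Ψ.analysis.adjoint := by
        ext1 y
        conv_lhs => rw [hdec y]
        rw [map_add, iw.pow (n + 1), pow_succ (A.incl w), mul_apply_eq_comp,
          kw _ (Ψ.adjoint_analysis_sub_rangeProj y), map_zero, add_zero]
        rfl
      rw [h1]
      have h2 : ‖wH ^ (n + 1)‖ ≤ (33 / 1024 : ℝ) ^ (n + 1) :=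
        (norm_pow_le' wH (Nat.succ_pos n)).trans (by gcongr)
      calc _ ≤ ‖Ψ.analysis‖ * (‖wH ^ (n + 1)‖ *
            (‖Ring.inverse Ψ.frameOp‖ * ‖Ψ.analysis.adjoint‖)) := by
            refine (ContinuousLinearMap.opNorm_comp_le _ _).trans ?_
            gcongr
            refine (ContinuousLinearMap.opNorm_comp_le _ _).trans ?_
            gcongr
            exact ContinuousLinearMap.opNorm_comp_le _ _
        _ ≤ ‖Ψ.analysis‖ * ((33 / 1024 : ℝ) ^ (n + 1) *
            (‖Ring.inverse Ψ.frameOp‖ * ‖Ψ.analysis.adjoint‖)) := by gcongr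
        _ ≤ _ := by
            rw [hM, add_mul, one_mul]
            have : (0 : ℝ) < (33 / 1024) ^ (n + 1) := by positivity
            linarith
  -- Any radius between 33/1024 and 1/4 would do: the central binomial coefficients grow like 4^n.
  -- By spectral invariance the bound holds in the algebra, where the series is summed next.
  have hr : spectralRadius ℂ w < ENNReal.ofReal (1 / 8) := by
    rw [← A.spectralRadius_incl]
    refine (spectralRadius_le_of_norm_pow_le _ (by norm_num) hwpow).trans_lt ?_
    rw [ENNReal.ofReal_lt_ofReal_iff (by norm_num)]
    norm_num
  obtain ⟨M', -, hM'⟩ := exists_norm_pow_le_of_spectralRadius_lt w hr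
  have hsA := (summable_norm_centralBinom_smul_pow (by norm_num) (by norm_num) hM').of_norm.hasSum
  set S := ∑' n : ℕ, (n.centralBinom : ℂ) • w ^ n with hS
  have hgD : g ∈ Subalgebra.centralizer ℂ (Set.centralizer {g}) := by
    rw [Subalgebra.mem_centralizer_iff]
    intro b hb
    exact (hb g rfl).symm
  have hxD : x ∈ Subalgebra.centralizer ℂ (Set.centralizer {g}) :=
    pow_mem (sub_mem (one_mem _) (Subalgebra.smul_mem _ hgD _)) N
  have heD : e ∈ Subalgebra.centralizer ℂ (Set.centralizer {g}) := sub_mem (one_mem _) hxD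
  have hwD : w ∈ Subalgebra.centralizer ℂ (Set.centralizer {g}) :=
    mul_mem heD (sub_mem (one_mem _) heD)
  have hsB := A.hasSum_incl_of_mem_centralizer hgs (a := fun n : ℕ => (n.centralBinom : ℂ) • w ^ n)
    (fun n => Subalgebra.smul_mem _ (pow_mem hwD n) _) hsA
  simp only [map_smul, map_pow] at hsB
  have hpowH : ∀ n, ‖wH ^ n‖ ≤ 1 * (33 / 1024 : ℝ) ^ n := by
    intro n
    rw [one_mul]
    rcases n with _ | n
    · simpa using h1H
    · exact (norm_pow_le' wH (Nat.succ_pos n)).trans (by gcongr)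
  have hsH := (summable_norm_centralBinom_smul_pow (by norm_num) (by norm_num)
    hpowH).of_norm.hasSum
  have iS := Intertwines.hasSum (fun n => (iw.pow n).smul (n.centralBinom : ℂ)) hsB hsH
  have hFH := half_add_mul_tsum_centralBinom_eq_one h1H (e := eH) (by rw [heH1]; exact hxHn)
  -- On the range of C this acts as 1, by `half_add_mul_tsum_centralBinom_eq_one` on H; on the
  -- kernel of C* it acts as 1/2 - 1/2 = 0. Hence it is P.
  set F : A.Carrier := (1 / 2 : ℂ) • 1 + (e - (1 / 2 : ℂ) • 1) * S with hF
  have hFi : A.incl F = (1 / 2 : ℂ) • 1 + (A.incl e - (1 / 2 : ℂ) • 1) * A.incl S := by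
    rw [hF, map_add, map_smul, map_mul, map_sub, map_smul, map_one]
  have iF : Ψ.Intertwines (A.incl F) 1 := by
    rw [← hFH, hFi]
    exact (Intertwines.one.smul _).add ((ie.sub (Intertwines.one.smul _)).mul iS)
  have kS : ∀ z, Ψ.analysis.adjoint z = 0 → A.incl S z = z := by
    intro z hz
    have h1 := hsB.mapL (ContinuousLinearMap.apply ℂ _ z)
    refine h1.unique ?_
    have h2 := hasSum_ite_eq 0 z
    convert h2 using 2 with n
    rcases n with _ | n
    · simp
    · rw [ContinuousLinearMap.apply_apply, _root_.smul_apply, pow_succ,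
        mul_apply_eq_comp, kw z hz, map_zero, smul_zero, if_neg (Nat.succ_ne_zero n)]
  have kF : ∀ z, Ψ.analysis.adjoint z = 0 → A.incl F z = 0 := by
    intro z hz
    rw [hFi, _root_.add_apply, mul_apply_eq_comp, kS z hz,
      _root_.sub_apply, ke z hz]
    simp
  have hfin : A.incl F = Ψ.rangeProj := by
    ext1 y
    conv_lhs => rw [hdec y]
    rw [map_add, iF, kF _ (Ψ.adjoint_analysis_sub_rangeProj y), add_zero]
    rfl
  rw [← hfin]
  exact A.incl_mem F

/-- G and the dual Gram operator are inverse to each other on the range of P. Adding 1 - P to both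
makes them inverse on all of ℓ², so inverse-closedness applies. -/
theorem dualGramOp_mem {A : ARIAlgebra K} (hG : Ψ.gramOp ∈ A.alg) : Ψ.dualGramOp ∈ A.alg := by
  have hP := Ψ.rangeProj_mem hG
  set B := Ψ.gramOp + (1 - Ψ.rangeProj) with hB
  set B' := Ψ.dualGramOp + (1 - Ψ.rangeProj) with hB'
  have h1 : B * B' = 1 := by
    simp only [hB, hB', add_mul, mul_add, mul_sub, sub_mul, mul_one, one_mul,
      gramOp_mul_dualGramOp, gramOp_mul_rangeProj, rangeProj_mul_dualGramOp,
      rangeProj_mul_rangeProj]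
    abel
  have h2 : B' * B = 1 := by
    simp only [hB, hB', add_mul, mul_add, mul_sub, sub_mul, mul_one, one_mul,
      dualGramOp_mul_gramOp, dualGramOp_mul_rangeProj, rangeProj_mul_gramOp,
      rangeProj_mul_rangeProj]
    abel
  have hmem : B ∈ A.alg := add_mem hG (sub_mem (one_mem _) hP)
  have hinv := A.inverse_closed B hmem ⟨⟨B, B', h1, h2⟩, rfl⟩
  have h3 : Ring.inverse B = B' := Ring.inverse_unit (⟨B, B', h1, h2⟩ : Units _)
  rw [h3] at hinv
  have h4 : Ψ.dualGramOp = B' - (1 - Ψ.rangeProj) := by rw [hB']; abel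
  rw [h4]
  exact sub_mem hinv (sub_mem (one_mem _) hP)

end HilbertFrame

/-! ### Weighted sequence spaces as isometric copies of ℓ^p -/

namespace WeightedLp

variable {K : Type u} (m : PosWeight K) (p : ℝ≥0∞)

theorem toLp_apply (c : WeightedLp m p) (k : K) : toLp m p c k = m k * c.1 k := rfl

/-- The map `x ↦ x / m` from `ℓ^p(K)` to `ℓ^p_m(K)`. -/
def ofLp (x : lp (fun _ : K => ℂ) p) : WeightedLp m p :=
  ⟨fun k => (m k : ℂ)⁻¹ * x k, by
    have h : Memℓp (fun k => (m k : ℂ) * ((m k : ℂ)⁻¹ * x k)) p := by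
      simp only [mul_inv_cancel_left₀ (IsWeightConj.weight_ne_zero m _)]
      exact x.2
    exact h⟩

theorem ofLp_apply (x : lp (fun _ : K => ℂ) p) (k : K) :
    (ofLp m p x).1 k = (m k : ℂ)⁻¹ * x k := rfl

variable {m p} in
theorem ext' {c d : WeightedLp m p} (h : ∀ k, c.1 k = d.1 k) : c = d :=
  Subtype.ext (funext h)

variable [Fact (1 ≤ p)]

/-- `ℓ^p_m(K)` and `ℓ^p(K)` are isometric. -/
def equivLp : WeightedLp m p ≃ₗᵢ[ℂ] lp (fun _ : K => ℂ) p where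
  toLinearEquiv := LinearEquiv.ofBijective (toLp m p) ⟨toLp_injective m p, fun x =>
    ⟨ofLp m p x, lp.ext (funext fun k => by
      rw [toLp_apply, ofLp_apply, mul_inv_cancel_left₀ (IsWeightConj.weight_ne_zero m k)])⟩⟩
  norm_map' _ := rfl

theorem equivLp_apply (c : WeightedLp m p) (k : K) : equivLp m p c k = m k * c.1 k := rfl

theorem equivLp_symm_apply (x : lp (fun _ : K => ℂ) p) (k : K) :
    ((equivLp m p).symm x).1 k = (m k : ℂ)⁻¹ * x k := by
  have h : (equivLp m p).symm x = ofLp m p x := by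
    rw [LinearIsometryEquiv.symm_apply_eq]
    refine lp.ext (funext fun k => ?_)
    rw [equivLp_apply, ofLp_apply, mul_inv_cancel_left₀ (IsWeightConj.weight_ne_zero m k)]
  rw [h, ofLp_apply]

instance : CompleteSpace (WeightedLp m p) :=
  (equivLp m p).toIsometryEquiv.completeSpace

variable {m p}

theorem norm_mul_apply_le (c : WeightedLp m p) (k : K) : m k * ‖c.1 k‖ ≤ ‖c‖ := by
  have h := lp.norm_apply_le_norm (zero_lt_one.trans_le (Fact.out : 1 ≤ p)).ne' (toLp m p c) k
  rwa [toLp_apply, norm_mul, Complex.norm_real, Real.norm_of_nonneg (m.pos k).le] at h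

end WeightedLp

theorem ActsBoundedly.exists_clm {K : Type u} {M : Matrix K K ℂ} {p : ℝ≥0∞} [Fact (1 ≤ p)]
    {m : PosWeight K} (h : ActsBoundedly M p m) :
    ∃ T : WeightedLp m p →L[ℂ] WeightedLp m p,
      ∀ c k, HasSum (fun l => M k l * c.1 l) ((T c).1 k) := by
  obtain ⟨C, hC⟩ := h
  choose T hT hTn using hC
  let L : WeightedLp m p →ₗ[ℂ] WeightedLp m p :=
    { toFun := T
      map_add' := fun c d => WeightedLp.ext' fun k => by
        refine (hT (c + d) k).unique ?_
        have h1 := (hT c k).add (hT d k)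
        simp only [← mul_add] at h1
        exact h1
      map_smul' := fun a c => WeightedLp.ext' fun k => by
        refine (hT (a • c) k).unique ?_
        have h1 := (hT c k).mul_left a
        simp only [mul_left_comm a] at h1
        exact h1 }
  exact ⟨L.mkContinuous C hTn, hT⟩

/-! ### Conjugation by admissible weights and the spectral radius -/

namespace ARIAlgebra

variable {K : Type u} {A : ARIAlgebra K}

/-- The action on ℓ²_w, transported to ℓ² by the isometry diag(w), is the conjugated operator. -/
theorem exists_isWeightConj {T : lp (fun _ : K => ℂ) 2 →L[ℂ] lp (fun _ : K => ℂ) 2}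
    (hT : T ∈ A.alg) {w : PosWeight K} (hw : w ∈ A.W) : ∃ T', IsWeightConj w T T' := by
  classical
  obtain ⟨S, hS⟩ := (A.regular T hT w hw 2).exists_clm
  let Φ := WeightedLp.equivLp w 2
  refine ⟨(Φ : WeightedLp w 2 →L[ℂ] _) ∘L S ∘L (Φ.symm : _ →L[ℂ] WeightedLp w 2),
    fun k l => ?_⟩
  have h1 := hS (Φ.symm (unitVec l)) k
  have h2 : ∀ j, opMatrix T k j * (Φ.symm (unitVec l)).1 j
      = if j = l then opMatrix T k l * (w l : ℂ)⁻¹ else 0 := by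
    intro j
    rw [WeightedLp.equivLp_symm_apply, unitVec_apply]
    split_ifs with hj
    · rw [hj, mul_one]
    · simp
  simp only [h2] at h1
  have h3 := h1.unique (hasSum_ite_eq l _)
  rw [mul_assoc, ← h3]
  rfl

/-- A resolvent of T lies in the algebra by inverse-closedness, so it can be conjugated as well, and
its conjugate is a resolvent of T'. -/
theorem spectralRadius_le_of_isWeightConj
    {T T' : lp (fun _ : K => ℂ) 2 →L[ℂ] lp (fun _ : K => ℂ) 2}
    (hT : T ∈ A.alg) {w : PosWeight K} (hw : w ∈ A.W) (h : IsWeightConj w T T') :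
    spectralRadius ℂ T' ≤ spectralRadius ℂ T := by
  have hsub : spectrum ℂ T' ⊆ spectrum ℂ T := by
    intro z hz hz'
    refine hz ?_
    rw [resolventSet, Set.mem_ofPred_eq, Algebra.algebraMap_eq_smul_one] at hz' ⊢
    have hmem : z • (1 : lp (fun _ : K => ℂ) 2 →L[ℂ] lp (fun _ : K => ℂ) 2) - T ∈ A.alg :=
      sub_mem (A.alg.smul_mem (OneMemClass.one_mem A.alg) z) hT
    obtain ⟨R, hR⟩ := exists_isWeightConj (A.inverse_closed _ hmem hz') hw
    have hc : IsWeightConj w (z • 1 - T) (z • 1 - T') := (IsWeightConj.one.smul z).sub h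
    have h1 := hc.mul hR
    have h2 := hR.mul hc
    rw [Ring.mul_inverse_cancel _ hz'] at h1
    rw [Ring.inverse_mul_cancel _ hz'] at h2
    exact ⟨⟨_, R, h1.unique IsWeightConj.one, h2.unique IsWeightConj.one⟩, rfl⟩
  exact biSup_mono hsub

end ARIAlgebra

/-- The three-point form of the interpolation inequality, for the weights `1/μ`, `1` and `√μ`. -/
theorem IsWeightConj.norm_pow_three_le {K : Type u} {μ : PosWeight K}
    {Y Z X : lp (fun _ : K => ℂ) 2 →L[ℂ] lp (fun _ : K => ℂ) 2}
    (hZ : IsWeightConj μ.sqrt Y Z) (hX : IsWeightConj μ⁻¹ Y X) : ‖Y‖ ^ 3 ≤ ‖Z‖ ^ 2 * ‖X‖ := by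
  have h0 : IsWeightConj μ X Y := hX.symm'
  -- V is the conjugate of Y with exponent -1/2, halfway between X (exponent -1) and Y (exponent 0);
  -- in turn Y is halfway between V and Z (exponent 1/2). The two midpoint inequalities are combined
  -- below.
  obtain ⟨V, hV, hVn⟩ := h0.exists_sqrt
  have hs : ∀ k, (μ k : ℂ) = μ.sqrt k * μ.sqrt k := fun k => by
    rw [← Complex.ofReal_mul, μ.sqrt_mul_sqrt]
  have hVY : IsWeightConj μ.sqrt V Y := by
    intro k l
    rw [hV, h0, hs, hs]
    have := IsWeightConj.weight_ne_zero μ.sqrt k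
    have := IsWeightConj.weight_ne_zero μ.sqrt l
    field_simp
  have hVZ : IsWeightConj μ V Z := by
    intro k l
    rw [hZ, hVY, hs, hs]
    have := IsWeightConj.weight_ne_zero μ.sqrt k
    have := IsWeightConj.weight_ne_zero μ.sqrt l
    field_simp
  have h1 := hVZ.norm_sq_le hVY
  rcases (norm_nonneg Y).eq_or_lt with hY | hY
  · rw [← hY, zero_pow three_ne_zero]; positivity
  · have h2 : ‖Y‖ ^ 4 ≤ (‖X‖ * ‖Y‖) * ‖Z‖ ^ 2 := by
      calc ‖Y‖ ^ 4 = (‖Y‖ ^ 2) ^ 2 := by ring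
        _ ≤ (‖V‖ * ‖Z‖) ^ 2 := by gcongr
        _ = ‖V‖ ^ 2 * ‖Z‖ ^ 2 := by ring
        _ ≤ _ := by gcongr
    refine le_of_mul_le_mul_right ?_ hY
    calc ‖Y‖ ^ 3 * ‖Y‖ = ‖Y‖ ^ 4 := by ring
      _ ≤ _ := h2
      _ = _ := by ring

/-- If the powers of `diag(√μ) Y diag(1/√μ)` decay exponentially on `ℓ²`, then so do those
of `Y`. -/
theorem ARIAlgebra.spectralRadius_lt_one_of_isWeightConj_sqrt {K : Type u} {A : ARIAlgebra K}
    {μ : PosWeight K} (hμ : μ ∈ A.W) {Y Z : lp (fun _ : K => ℂ) 2 →L[ℂ] lp (fun _ : K => ℂ) 2}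
    (hY : Y ∈ A.alg) (hZ : IsWeightConj μ.sqrt Y Z) {C θ : ℝ} (hθ0 : 0 < θ) (hθ1 : θ < 1)
    (hn : ∀ n, ‖Z ^ n‖ ≤ C * θ ^ n) : spectralRadius ℂ Y < 1 := by
  obtain ⟨X, hX⟩ := A.exists_isWeightConj hY (A.inv_mem μ hμ)
  have hXr := A.spectralRadius_le_of_isWeightConj hY (A.inv_mem μ hμ) hX
  have hC : 0 ≤ C := by simpa using (norm_nonneg _).trans (hn 0)
  by_contra! hge
  have hfin : spectralRadius ℂ Y ≠ ∞ :=
    ((spectralRadius_le_norm_mul_norm_one Y).trans_lt ENNReal.ofReal_lt_top).ne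
  set s := (spectralRadius ℂ Y).toReal with hs
  have hsY : spectralRadius ℂ Y = ENNReal.ofReal s := (ENNReal.ofReal_toReal hfin).symm
  have hs1 : 1 ≤ s := by
    rw [hsY] at hge
    exact (ENNReal.one_le_ofReal).1 hge
  have hs0 : 0 < s := by linarith
  -- The spectral radius s of Y bounds that of X, so powers of X grow at most like r^n with r
  -- slightly larger than s. The three-point inequality gives s³ ≤ θ² r, and this choice of r makes
  -- the right side θ s, which contradicts s ≥ 1.
  set r := s / θ with hr
  have hr0 : 0 < r := by positivity
  have hsr : s < r := by rw [hr, lt_div_iff₀ hθ0]; nlinarith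
  obtain ⟨M, hM0, hM⟩ := exists_norm_pow_le_of_spectralRadius_lt X (r := r)
    (hXr.trans_lt (by rw [hsY]; exact (ENNReal.ofReal_lt_ofReal_iff hr0).2 hsr))
  set β := (θ ^ 2 * r) ^ (1 / 3 : ℝ) with hβ
  have hβ0 : 0 ≤ β := by positivity
  have hβ3 : β ^ 3 = θ * s := by
    rw [hβ, ← Real.rpow_natCast, ← Real.rpow_mul (by positivity)]
    norm_num
    rw [hr]; field_simp
  have hbound : ∀ n, ‖Y ^ n‖ ≤ (C ^ 2 * M) ^ (1 / 3 : ℝ) * β ^ n := by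
    intro n
    have h1 := (hZ.pow n).norm_pow_three_le (hX.pow n)
    refine le_of_pow_le_pow_left₀ three_ne_zero (by positivity) (h1.trans ?_)
    have h2 : ((C ^ 2 * M) ^ (1 / 3 : ℝ)) ^ 3 = C ^ 2 * M := by
      rw [← Real.rpow_natCast, ← Real.rpow_mul (by positivity)]
      norm_num
    have h3 : β ^ 3 = θ ^ 2 * r := by rw [hβ3, hr]; field_simp
    rw [mul_pow, h2, pow_right_comm, h3]
    calc ‖Z ^ n‖ ^ 2 * ‖X ^ n‖ ≤ (C * θ ^ n) ^ 2 * (M * r ^ n) := by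
          gcongr
          · exact hn n
          · exact hM n
      _ = _ := by rw [mul_pow (θ ^ 2), ← pow_mul, mul_pow]; ring
  have h4 := spectralRadius_le_of_norm_pow_le Y hβ0 hbound
  rw [hsY, ENNReal.ofReal_le_ofReal_iff hβ0] at h4
  have h5 : s ^ 3 ≤ θ * s := by rw [← hβ3]; gcongr
  nlinarith [mul_le_mul hs1 hs1 zero_le_one hs0.le, mul_pos hs0 hs0]

/-! ### Relative invertibility of the matrix of the composed multipliers -/

namespace HilbertFrame

variable {K : Type u} {H : Type v} [NormedAddCommGroup H] [InnerProductSpace ℂ H]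
  [CompleteSpace H] (Ψ : HilbertFrame K H)

set_option maxHeartbeats 1000000 in
/-- The matrix `P G^{1/μ} G` of `M_{1/μ} M_μ` is invertible in the algebra, relative to the
projection `P` onto the range of the analysis operator. -/
theorem exists_inverse_rangeProj_mul {A : ARIAlgebra K} {μ : PosWeight K} (hμ : μ ∈ A.W)
    (hG : Ψ.gramOp ∈ A.alg) {N : lp (fun _ : K => ℂ) 2 →L[ℂ] lp (fun _ : K => ℂ) 2}
    (hN : N ∈ A.alg) (hNG : IsWeightConj μ⁻¹ Ψ.gramOp N) :
    ∃ R ∈ A.alg, R * (Ψ.rangeProj * N * Ψ.gramOp) = Ψ.rangeProj ∧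
      (Ψ.rangeProj * N * Ψ.gramOp) * R = Ψ.rangeProj ∧ Ψ.rangeProj * R = R := by
  have hP := Ψ.rangeProj_mem hG
  have hL := Ψ.dualGramOp_mem hG
  set P := Ψ.rangeProj with hPdef
  set G := Ψ.gramOp with hGdef
  set L := Ψ.dualGramOp with hLdef
  obtain ⟨Gμ, hGμ⟩ := A.exists_isWeightConj hG hμ
  obtain ⟨Pμ, hPμ⟩ := A.exists_isWeightConj hP hμ
  obtain ⟨Lμ, hLμ⟩ := A.exists_isWeightConj hL hμ
  -- V, Q, J are the √μ-conjugates of G, P and the dual Gram operator; their algebraic relations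
  -- carry over by uniqueness of conjugates.
  obtain ⟨V, hV, -⟩ := hGμ.exists_sqrt
  obtain ⟨Q, hQ, -⟩ := hPμ.exists_sqrt
  obtain ⟨J, hJ, -⟩ := hLμ.exists_sqrt
  have hVQ : V * Q = V := by
    have h := hV.mul hQ
    rw [Ψ.gramOp_mul_rangeProj] at h
    exact h.unique hV
  have hQV : Q * V = V := by
    have h := hQ.mul hV
    rw [Ψ.rangeProj_mul_gramOp] at h
    exact h.unique hV
  have hJV : J * V = Q := by
    have h := hJ.mul hV
    rw [Ψ.dualGramOp_mul_gramOp] at h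
    exact h.unique hQ
  have hVJ : V * J = Q := by
    have h := hV.mul hJ
    rw [Ψ.gramOp_mul_dualGramOp] at h
    exact h.unique hQ
  -- Both sides are diag(1/√μ) G diag(√μ).
  have hVN : IsWeightConj μ.sqrt N V.adjoint := by
    have h := hV.adjoint
    rw [hGdef, Ψ.adjoint_gramOp] at h
    have h2 := hNG.symm'
    have hs : ∀ k, (μ k : ℂ) = μ.sqrt k * μ.sqrt k := fun k => by
      rw [← Complex.ofReal_mul, μ.sqrt_mul_sqrt]
    intro k l
    have h3 := h k l
    have h4 := h2 k l
    have e1 := IsWeightConj.weight_ne_zero μ.sqrt k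
    have e2 := IsWeightConj.weight_ne_zero μ.sqrt l
    rw [h4, hs, hs] at h3
    field_simp at h3 ⊢
    linear_combination -h3
  -- The summand 2 forces t ≤ 1/2, hence tc < 1, so that the rate θ is strictly positive as the
  -- spectral radius lemma requires.
  set t : ℝ := (‖V‖ ^ 2 + 2)⁻¹ with ht
  have htpos : 0 < t := by positivity
  have htV : t * ‖V‖ ^ 2 ≤ 1 := by
    rw [ht, inv_mul_le_iff₀ (by positivity)]; linarith
  set c : ℝ := (‖J‖ ^ 2 + 1)⁻¹ with hc
  have hcpos : 0 < c := by positivity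
  have htc : t * c < 1 := by
    have h1 : t ≤ 2⁻¹ := inv_anti₀ two_pos (by linarith [sq_nonneg ‖V‖])
    have h2 : c ≤ 1 := inv_le_one_of_one_le₀ (by linarith [sq_nonneg ‖J‖])
    nlinarith
  set θ := Real.sqrt (1 - t * c) with hθ
  have hθ0 : 0 < θ := Real.sqrt_pos.2 (by linarith)
  have hθ1 : θ < 1 := by
    rw [hθ, Real.sqrt_lt' one_pos]
    linarith [mul_pos htpos hcpos]
  set X := P * N * G with hX
  set Y := P - (t : ℂ) • X with hY
  set Z := Q - (t : ℂ) • (Q * V.adjoint * V) with hZ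
  have hYZ : IsWeightConj μ.sqrt Y Z := hQ.sub (((hQ.mul hVN).mul hV).smul _)
  set E := 1 - (t : ℂ) • (V * V.adjoint) with hE
  -- Z is not self-adjoint, since Q is in general an oblique projection; V intertwines it with the
  -- self-adjoint E = 1 - tVV*.
  have hVZ : V * Z = E * V := by
    rw [hZ, hE, mul_sub, sub_mul, hVQ, one_mul, mul_smul_comm, smul_mul_assoc, ← mul_assoc,
      ← mul_assoc, hVQ]
  have hVZn : ∀ n : ℕ, V * Z ^ n = E ^ n * V := by
    intro n
    induction n with
    | zero => rw [pow_zero, pow_zero, mul_one, one_mul]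
    | succ n ih => rw [pow_succ', ← mul_assoc, hVZ, mul_assoc, ih, ← mul_assoc, ← pow_succ']
  have hEV : ∀ z, ‖E (V z)‖ ≤ θ * ‖V z‖ := by
    intro z
    have hy : V (J (V z)) = V z := by
      have h1 := congrArg (fun T : lp (fun _ : K => ℂ) 2 →L[ℂ] lp (fun _ : K => ℂ) 2 => T (V z)) hVJ
      have h2 := congrArg (fun T : lp (fun _ : K => ℂ) 2 →L[ℂ] lp (fun _ : K => ℂ) 2 => T z) hQV
      exact h1.trans h2
    set y := V z with hyz
    -- For y in the range of V one has V J y = y, so ‖y‖² = ⟨J y, V* y⟩; this bounds V* from below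
    -- on that range.
    have h1 : ‖y‖ ^ 2 ≤ ‖J‖ * ‖y‖ * ‖V.adjoint y‖ := by
      have h2 : ‖⟪J y, V.adjoint y⟫_ℂ‖ = ‖y‖ ^ 2 := by
        rw [ContinuousLinearMap.adjoint_inner_right, hy, inner_self_eq_norm_sq_to_K, norm_pow,
          RCLike.norm_ofReal, abs_norm]
      rw [← h2]
      refine (norm_inner_le_norm _ _).trans ?_
      gcongr
      exact J.le_opNorm y
    have h3 : ‖y‖ ≤ ‖J‖ * ‖V.adjoint y‖ := by
      rcases (norm_nonneg y).eq_or_lt with h0 | h0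
      · rw [← h0]; positivity
      · nlinarith
    have h4 : c * ‖y‖ ^ 2 ≤ ‖V.adjoint y‖ ^ 2 := by
      rw [hc, inv_mul_le_iff₀ (by positivity)]
      calc ‖y‖ ^ 2 ≤ (‖J‖ * ‖V.adjoint y‖) ^ 2 := by gcongr
        _ ≤ _ := by nlinarith [sq_nonneg ‖V.adjoint y‖]
    have h5 := norm_sq_sub_smul_comp_adjoint_le V htpos.le htV h4
    refine (abs_le_of_sq_le_sq' ?_ (by positivity)).2
    rw [mul_pow, Real.sq_sqrt (by linarith)]
    exact h5
  have hEn : ∀ n z, ‖(E ^ n) (V z)‖ ≤ θ ^ n * ‖V z‖ := by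
    intro n z
    induction n with
    | zero => rw [pow_zero, pow_zero, one_mul]; exact le_rfl
    | succ n ih =>
      have h1 : (E ^ n) (V z) = V ((Z ^ n) z) := congrArg
        (fun T : lp (fun _ : K => ℂ) 2 →L[ℂ] lp (fun _ : K => ℂ) 2 => T z) (hVZn n).symm
      rw [pow_succ', mul_apply_eq_comp, h1]
      refine (hEV _).trans ?_
      rw [← h1, pow_succ', mul_assoc]
      gcongr
  have hQQ : Q * Q = Q := by
    have h := hQ.mul hQ
    rw [Ψ.rangeProj_mul_rangeProj] at h
    exact h.unique hQ
  have hQZ : Q * Z = Z := by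
    rw [hZ, mul_sub, hQQ, mul_smul_comm, ← mul_assoc, ← mul_assoc, hQQ]
  have hZn : ∀ n, ‖Z ^ n‖ ≤ (1 + ‖J‖ * ‖V‖) * θ ^ n := by
    intro n
    rcases n with _ | n
    · rw [pow_zero, pow_zero, mul_one]
      have h0 : 0 ≤ ‖J‖ * ‖V‖ := by positivity
      exact le_trans ContinuousLinearMap.norm_id_le (by linarith)
    · refine ContinuousLinearMap.opNorm_le_bound _ (by positivity) fun z => ?_
      -- J V = Q and Q Z = Z recover Z^(n+1) from V Z^(n+1); this fails for the zeroth power, which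
      -- is treated separately.
      have h1 : Z ^ (n + 1) = J * (E ^ (n + 1) * V) := by
        rw [← hVZn, ← mul_assoc, hJV, pow_succ', ← mul_assoc, hQZ]
      rw [h1, mul_apply_eq_comp, mul_apply_eq_comp]
      calc ‖J ((E ^ (n + 1)) (V z))‖ ≤ ‖J‖ * ‖(E ^ (n + 1)) (V z)‖ := J.le_opNorm _
        _ ≤ ‖J‖ * (θ ^ (n + 1) * (‖V‖ * ‖z‖)) := by
            gcongr
            refine (hEn (n + 1) z).trans ?_
            gcongr
            exact V.le_opNorm z
        _ = (0 + ‖J‖ * ‖V‖) * θ ^ (n + 1) * ‖z‖ := by ring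
        _ ≤ _ := by gcongr; exact zero_le_one
  have hXmem : X ∈ A.alg := mul_mem (mul_mem hP hN) hG
  have hYmem : Y ∈ A.alg := sub_mem hP (A.alg.smul_mem hXmem _)
  have hrad := A.spectralRadius_lt_one_of_isWeightConj_sqrt hμ hYmem hYZ hθ0 hθ1 hZn
  have hunit : IsUnit (1 - Y) := by
    have h1 := spectrum.mem_resolventSet_of_spectralRadius_lt (𝕜 := ℂ) (a := Y) (k := 1)
      (by simpa using hrad)
    rwa [spectrum.mem_resolventSet_iff, map_one] at h1
  set U := 1 - Y with hU
  have hUmem : U ∈ A.alg := sub_mem (OneMemClass.one_mem A.alg) hYmem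
  have hinv := A.inverse_closed U hUmem hunit
  have hUU := Ring.mul_inverse_cancel U hunit
  have hUU' := Ring.inverse_mul_cancel U hunit
  set U' := Ring.inverse U with hU'
  have hPP : P * P = P := Ψ.rangeProj_mul_rangeProj
  have hPX : P * X = X := by rw [hX, ← mul_assoc, ← mul_assoc, hPP]
  have hXP : X * P = X := by rw [hX, mul_assoc, Ψ.gramOp_mul_rangeProj]
  -- U agrees with tX on the range of P and commutes with P, so t U⁻¹ P inverts X relative to P.
  have hUP : U * P = (t : ℂ) • X := by
    rw [hU, hY, sub_mul, sub_mul, one_mul, hPP, smul_mul_assoc, hXP]; abel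
  have hPU : P * U = (t : ℂ) • X := by
    rw [hU, hY, mul_sub, mul_sub, mul_one, hPP, mul_smul_comm, hPX]; abel
  have hcomm : P * U' = U' * P := by
    calc P * U' = U' * U * (P * U') := by rw [hUU', one_mul]
      _ = U' * (U * P) * U' := by simp only [mul_assoc]
      _ = U' * (P * U) * U' := by rw [hUP, hPU]
      _ = U' * P * (U * U') := by simp only [mul_assoc]
      _ = U' * P := by rw [hUU, mul_one]
  refine ⟨(t : ℂ) • (U' * P), A.alg.smul_mem (mul_mem hinv hP) _, ?_, ?_, ?_⟩
  · rw [smul_mul_assoc, mul_assoc, hPX, ← mul_smul_comm, ← hUP, ← mul_assoc, hUU', one_mul]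
  · rw [mul_smul_comm, ← smul_mul_assoc, ← hPU, mul_assoc, ← mul_assoc U, hUU, one_mul, hPP]
  · rw [mul_smul_comm, ← mul_assoc, hcomm, mul_assoc, hPP]

end HilbertFrame

/-! ### The action of the algebra on weighted sequence spaces -/

namespace ARIAlgebra

variable {K : Type u} {A : ARIAlgebra K}

/-- The action on `ℓ^p_w(K)` of a matrix of the algebra. -/
def act {T : lp (fun _ : K => ℂ) 2 →L[ℂ] lp (fun _ : K => ℂ) 2} (hT : T ∈ A.alg)
    {w : PosWeight K} (hw : w ∈ A.W) (p : ℝ≥0∞) [Fact (1 ≤ p)] :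
    WeightedLp w p →L[ℂ] WeightedLp w p :=
  (A.regular T hT w hw p).exists_clm.choose

variable {S T : lp (fun _ : K => ℂ) 2 →L[ℂ] lp (fun _ : K => ℂ) 2} {w : PosWeight K}

theorem hasSum_act (hT : T ∈ A.alg) (hw : w ∈ A.W) {p : ℝ≥0∞} [Fact (1 ≤ p)]
    (c : WeightedLp w p) (k : K) :
    HasSum (fun l => opMatrix T k l * c.1 l) ((act hT hw p c).1 k) :=
  (A.regular T hT w hw p).exists_clm.choose_spec c k

/-- A matrix that is bounded on `ℓ^∞_w` has uniformly bounded weighted absolute row sums. -/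
theorem exists_row_bound (hT : T ∈ A.alg) (hw : w ∈ A.W) :
    ∃ C : ℝ, 0 ≤ C ∧ ∀ k, (Summable fun l => ‖opMatrix T k l‖ * (w l)⁻¹) ∧
      ∑' l, ‖opMatrix T k l‖ * (w l)⁻¹ ≤ C * (w k)⁻¹ := by
  refine ⟨‖act hT hw ∞‖, norm_nonneg _, fun k => ?_⟩
  -- This test sequence cancels the phases of row k. Where the entry is 0 the inverse is 0 by
  -- convention, and the bound by 1 persists.
  let x : K → ℂ := fun l => conj (opMatrix T k l) * ((‖opMatrix T k l‖ : ℂ))⁻¹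
  have hx : ∀ l, ‖x l‖ ≤ 1 := by
    intro l
    rw [norm_mul, norm_inv, Complex.norm_real, norm_norm, RCLike.norm_conj]
    exact mul_inv_le_one
  have hxm : Memℓp x ∞ := memℓp_infty ⟨1, by rintro _ ⟨l, rfl⟩; exact hx l⟩
  let c : WeightedLp w ∞ := (WeightedLp.equivLp w ∞).symm ⟨x, hxm⟩
  have hc : ‖c‖ ≤ 1 := by
    rw [LinearIsometryEquiv.norm_map]
    exact lp.norm_le_of_forall_le zero_le_one hx
  have h1 := hasSum_act hT hw c k
  have h2 : ∀ l, opMatrix T k l * c.1 l = ((‖opMatrix T k l‖ * (w l)⁻¹ : ℝ) : ℂ) := by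
    intro l
    have h3 : c.1 l = (w l : ℂ)⁻¹ * x l := WeightedLp.equivLp_symm_apply _ _ _ _
    rw [h3]
    rcases eq_or_ne (opMatrix T k l) 0 with h0 | h0
    · simp [h0]
    · have h4 : (‖opMatrix T k l‖ : ℂ) ≠ 0 := by simpa using h0
      calc opMatrix T k l * ((w l : ℂ)⁻¹ * x l)
          = (opMatrix T k l * conj (opMatrix T k l)) * (‖opMatrix T k l‖ : ℂ)⁻¹ * (w l : ℂ)⁻¹ := by
            simp only [x]; ring
        _ = _ := by
            rw [Complex.mul_conj, Complex.normSq_eq_norm_sq]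
            push_cast
            field_simp
  simp only [h2] at h1
  have hs : Summable fun l => ‖opMatrix T k l‖ * (w l)⁻¹ := Complex.summable_ofReal.1 h1.summable
  refine ⟨hs, ?_⟩
  have h5 : ((∑' l, ‖opMatrix T k l‖ * (w l)⁻¹ : ℝ) : ℂ) = (act hT hw ∞ c).1 k := by
    rw [Complex.ofReal_tsum]; exact h1.tsum_eq
  have h6 : ∑' l, ‖opMatrix T k l‖ * (w l)⁻¹ = ‖(act hT hw ∞ c).1 k‖ := by
    rw [← h5, Complex.norm_real, Real.norm_of_nonneg]
    exact tsum_nonneg fun l => mul_nonneg (norm_nonneg _) (inv_nonneg.2 (w.pos l).le)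
  rw [h6, ← div_eq_mul_inv, le_div_iff₀ (w.pos k), mul_comm]
  refine (WeightedLp.norm_mul_apply_le _ k).trans ?_
  calc ‖act hT hw ∞ c‖ ≤ ‖act hT hw ∞‖ * ‖c‖ := (act hT hw ∞).le_opNorm c
    _ ≤ ‖act hT hw ∞‖ * 1 := by gcongr
    _ = _ := mul_one _

/-- Every c in ℓ^p_w is bounded by ‖c‖/w, so the absolute row sums dominate the double series for
all p together. This is the absolute convergence behind each interchange of sums below. -/
theorem summable_mul_opMatrix_mul (hT : T ∈ A.alg) (hw : w ∈ A.W) {p : ℝ≥0∞} [Fact (1 ≤ p)]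
    {a : K → ℂ} (ha : Summable fun j => ‖a j‖ * (w j)⁻¹) (c : WeightedLp w p) :
    Summable fun x : K × K => a x.1 * (opMatrix T x.1 x.2 * c.1 x.2) := by
  obtain ⟨C, hC0, hC⟩ := exists_row_bound hT hw
  have hc : ∀ l, ‖c.1 l‖ ≤ ‖c‖ * (w l)⁻¹ := fun l => by
    rw [← div_eq_mul_inv, le_div_iff₀ (w.pos l), mul_comm]
    exact WeightedLp.norm_mul_apply_le c l
  have hle : ∀ j l, ‖a j * (opMatrix T j l * c.1 l)‖
      ≤ ‖a j‖ * ‖c‖ * (‖opMatrix T j l‖ * (w l)⁻¹) := by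
    intro j l
    rw [norm_mul, norm_mul]
    calc ‖a j‖ * (‖opMatrix T j l‖ * ‖c.1 l‖)
        ≤ ‖a j‖ * (‖opMatrix T j l‖ * (‖c‖ * (w l)⁻¹)) := by gcongr; exact hc l
      _ = _ := by ring
  refine Summable.of_norm ((summable_prod_of_nonneg fun _ => norm_nonneg _).2 ⟨fun j => ?_, ?_⟩)
  · exact Summable.of_nonneg_of_le (fun _ => norm_nonneg _) (hle j) ((hC j).1.mul_left _)
  · refine Summable.of_nonneg_of_le (fun _ => tsum_nonneg fun _ => norm_nonneg _) (fun j => ?_)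
      (ha.mul_left (‖c‖ * C))
    calc ∑' l, ‖a j * (opMatrix T j l * c.1 l)‖
        ≤ ∑' l, ‖a j‖ * ‖c‖ * (‖opMatrix T j l‖ * (w l)⁻¹) :=
          Summable.tsum_le_tsum (hle j)
            (Summable.of_nonneg_of_le (fun _ => norm_nonneg _) (hle j) ((hC j).1.mul_left _))
            ((hC j).1.mul_left _)
      _ = ‖a j‖ * ‖c‖ * ∑' l, ‖opMatrix T j l‖ * (w l)⁻¹ := tsum_mul_left
      _ ≤ ‖a j‖ * ‖c‖ * (C * (w j)⁻¹) := by gcongr; exact (hC j).2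
      _ = _ := by ring

/-- Boundedness alone does not give multiplicativity for p = ∞, where finite sequences are not
dense. The order of summation is interchanged instead, using the absolute row bounds. -/
theorem act_mul (hS : S ∈ A.alg) (hT : T ∈ A.alg) (hST : S * T ∈ A.alg) (hw : w ∈ A.W)
    {p : ℝ≥0∞} [Fact (1 ≤ p)] (c : WeightedLp w p) :
    act hST hw p c = act hS hw p (act hT hw p c) := by
  refine WeightedLp.ext' fun k => ?_
  obtain ⟨C, -, hC⟩ := exists_row_bound hS hw
  have hs := (summable_mul_opMatrix_mul hT hw (hC k).1 c).hasSum
  have h1 := hs.prod_fiberwise fun j => (hasSum_act hT hw c j).mul_left (opMatrix S k j)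
  have h2 := (HasSum.prod_fiberwise ((Equiv.prodComm K K).hasSum_iff.2 hs) fun l => by
    have h3 := (hasSum_opMatrix_comp S T k l).mul_right (c.1 l)
    simp only [mul_assoc] at h3
    exact h3)
  rw [← (hasSum_act hS hw _ k).unique h1] at h2
  exact (hasSum_act hST hw c k).unique h2

theorem act_mul_of_eq {R : lp (fun _ : K => ℂ) 2 →L[ℂ] lp (fun _ : K => ℂ) 2} (hS : S ∈ A.alg)
    (hT : T ∈ A.alg) (hR : R ∈ A.alg) (h : S * T = R) (hw : w ∈ A.W)
    {p : ℝ≥0∞} [Fact (1 ≤ p)] (c : WeightedLp w p) :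
    act hS hw p (act hT hw p c) = act hR hw p c := by
  subst h
  exact (act_mul hS hT hR hw c).symm

end ARIAlgebra

/-! ### Change of weight and unit vectors -/

namespace WeightedLp

variable {K : Type u} (w w' : PosWeight K) (p : ℝ≥0∞) [Fact (1 ≤ p)]

/-- Multiplication by `w / w'`, as an isometry of `ℓ^p_w` onto `ℓ^p_{w'}`. -/
def changeWeight : WeightedLp w p ≃ₗᵢ[ℂ] WeightedLp w' p :=
  (equivLp w p).trans (equivLp w' p).symm

variable {w w'}

theorem changeWeight_apply {μ : PosWeight K} (h : ∀ k, w k = μ k * w' k) (c : WeightedLp w p)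
    (k : K) : (changeWeight w w' p c).1 k = μ k * c.1 k := by
  have h1 : (changeWeight w w' p c).1 k = (w' k : ℂ)⁻¹ * (w k * c.1 k) :=
    equivLp_symm_apply _ _ _ _
  rw [h1, h, Complex.ofReal_mul]
  have := IsWeightConj.weight_ne_zero w' k
  field_simp

variable (w)

open scoped Classical in
/-- The canonical unit vector in `ℓ^p_w(K)`. -/
def delta (k : K) : WeightedLp w p := (equivLp w p).symm (lp.single p k (w k : ℂ))

open scoped Classical in
theorem delta_apply (k l : K) : (delta w p k).1 l = if l = k then 1 else 0 := by
  have h1 : (delta w p k).1 l = (w l : ℂ)⁻¹ * lp.single (E := fun _ : K => ℂ) p k (w k : ℂ) l :=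
    equivLp_symm_apply _ _ _ _
  rw [h1]
  by_cases h : l = k
  · subst h; simp [IsWeightConj.weight_ne_zero w l]
  · simp [h]

variable {w p}

theorem hasSum_smul_delta (hp : p ≠ ∞) (c : WeightedLp w p) :
    HasSum (fun k => c.1 k • delta w p k) c := by
  classical
  have h := (lp.hasSum_single hp (equivLp w p c)).mapL
    ((equivLp w p).symm : lp (fun _ : K => ℂ) p →L[ℂ] WeightedLp w p)
  have h2 : ∀ k, ((equivLp w p).symm : lp (fun _ : K => ℂ) p →L[ℂ] WeightedLp w p)
      (lp.single p k (equivLp w p c k)) = c.1 k • delta w p k := by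
    intro k
    rw [delta, ← map_smul, ← lp.single_smul, equivLp_apply, smul_eq_mul, mul_comm]
    rfl
  have h3 : ((equivLp w p).symm : lp (fun _ : K => ℂ) p →L[ℂ] WeightedLp w p) (equivLp w p c) = c :=
    (equivLp w p).symm_apply_apply c
  simp only [h2, h3] at h
  exact h

theorem summable_norm_mul_inv (c : WeightedLp w⁻¹ 1) : Summable fun k => ‖c.1 k‖ * (w k)⁻¹ := by
  have h := (lp.memℓp (equivLp w⁻¹ 1 c)).summable (by norm_num)
  refine h.congr fun k => ?_
  rw [equivLp_apply]
  have h1 : (w⁻¹ : PosWeight K) k = (w k)⁻¹ := rfl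
  rw [h1, norm_mul, Complex.norm_real, Real.norm_of_nonneg (inv_nonneg.2 (w.pos k).le), mul_comm]
  simp

end WeightedLp

/-! ### Coorbit spaces as fixed spaces of the projection, and frame multipliers -/

namespace HilbertFrame

variable {K : Type u} {H : Type v} [NormedAddCommGroup H] [InnerProductSpace ℂ H]
  [CompleteSpace H] (Ψ : HilbertFrame K H) {A : ARIAlgebra K} {w : PosWeight K}

/-- The reconstruction formula tested against the dual frame vectors: dual coefficients are fixed by
P. -/
theorem hasSum_rangeProj_mul_dualCoeff (f : H) (k : K) :
    HasSum (fun l => opMatrix Ψ.rangeProj k l * Ψ.dualCoeff f l) (Ψ.dualCoeff f k) := by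
  have h := (Ψ.hasSum_dual f).mapL (innerSL ℂ (Ψ.dual k))
  simp only [innerSL_apply_apply, inner_smul_right, ← opMatrix_rangeProj] at h
  simp only [mul_comm (opMatrix _ _ _)]
  exact h

theorem act_rangeProj_delta (hP : Ψ.rangeProj ∈ A.alg) (hw : w ∈ A.W) (p : ℝ≥0∞) [Fact (1 ≤ p)]
    (l : K) : (ARIAlgebra.act hP hw p (WeightedLp.delta w p l)).1 = Ψ.dualCoeff (Ψ.vec l) := by
  classical
  funext k
  have h := ARIAlgebra.hasSum_act hP hw (WeightedLp.delta w p l) k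
  have h1 : ∀ j, opMatrix Ψ.rangeProj k j * (WeightedLp.delta w p l).1 j
      = if j = l then opMatrix Ψ.rangeProj k l else 0 := by
    intro j
    rw [WeightedLp.delta_apply]
    split_ifs with hj
    · rw [hj, mul_one]
    · rw [mul_zero]
  simp only [h1] at h
  exact (h.unique (hasSum_ite_eq l _)).trans (Ψ.opMatrix_rangeProj k l)

theorem act_rangeProj_eq_of_eq_dualCoeff (hP : Ψ.rangeProj ∈ A.alg) (hw : w ∈ A.W) {p : ℝ≥0∞}
    [Fact (1 ≤ p)] {c : WeightedLp w p} {f : H} (hc : c.1 = Ψ.dualCoeff f) :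
    ARIAlgebra.act hP hw p c = c := by
  refine WeightedLp.ext' fun k => ?_
  have h1 := Ψ.hasSum_rangeProj_mul_dualCoeff f k
  rw [← hc] at h1
  exact (ARIAlgebra.hasSum_act hP hw c k).unique h1

theorem act_rangeProj_idem (hP : Ψ.rangeProj ∈ A.alg) (hw : w ∈ A.W) {p : ℝ≥0∞}
    [Fact (1 ≤ p)] (c : WeightedLp w p) :
    ARIAlgebra.act hP hw p (ARIAlgebra.act hP hw p c) = ARIAlgebra.act hP hw p c :=
  ARIAlgebra.act_mul_of_eq hP hP hP Ψ.rangeProj_mul_rangeProj hw c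

/-- For an admissible weight the coorbit space consists of the fixed points in `ℓ^p_w` of the
projection onto the range of the analysis operator. -/
theorem mem_coorbitSpace_iff [Countable K] (hP : Ψ.rangeProj ∈ A.alg) (hw : w ∈ A.W) {p : ℝ≥0∞}
    [Fact (1 ≤ p)] (c : WeightedLp w p) :
    c ∈ CoorbitSpace Ψ p w ↔ ARIAlgebra.act hP hw p c = c := by
  by_cases hp : p = ∞
  · subst hp
    rw [CoorbitSpace, if_pos rfl]
    obtain ⟨C, hC0, hC⟩ := ARIAlgebra.exists_row_bound hP hw
    constructor
    · rintro ⟨f, -, ⟨B, hB⟩, hf⟩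
      refine WeightedLp.ext' fun k => ?_
      -- The uniform bound B and the weighted row sums of P allow passing to the limit in P c_n =
      -- c_n by dominated convergence.
      have h1 : Filter.Tendsto (fun n => ∑' l, opMatrix Ψ.rangeProj k l * Ψ.dualCoeff (f n) l)
          Filter.atTop (nhds (∑' l, opMatrix Ψ.rangeProj k l * c.1 l)) := by
        refine tendsto_tsum_of_dominated_convergence ((hC k).1.mul_right B)
          (fun l => (hf l).const_mul _) (Filter.Eventually.of_forall fun n l => ?_)
        rw [norm_mul, mul_assoc]
        gcongr
        rw [← div_eq_inv_mul, le_div_iff₀ (w.pos l), mul_comm]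
        exact hB n l
      simp only [(Ψ.hasSum_rangeProj_mul_dualCoeff (f _) k).tsum_eq,
        (ARIAlgebra.hasSum_act hP hw c k).tsum_eq] at h1
      exact tendsto_nhds_unique h1 (hf k)
    · intro hc
      -- Countability of K provides a sequence of finite sets along which the sums of c_l ψ_l
      -- approximate c. Their coefficients are partial sums of P c = c, bounded by the row sums of
      -- P.
      obtain ⟨F, hF⟩ := Filter.exists_seq_tendsto (Filter.atTop : Filter (Finset K))
      have hcoef : ∀ n k, ⟪Ψ.dual k, ∑ l ∈ F n, c.1 l • Ψ.vec l⟫_ℂ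
          = ∑ l ∈ F n, opMatrix Ψ.rangeProj k l * c.1 l := by
        intro n k
        rw [inner_sum]
        refine Finset.sum_congr rfl fun l _ => ?_
        rw [inner_smul_right, opMatrix_rangeProj, mul_comm]
      refine ⟨fun n => ∑ l ∈ F n, c.1 l • Ψ.vec l, fun n => ?_, ⟨C * ‖c‖, fun n k => ?_⟩,
        fun k => ?_⟩
      · exact Submodule.sum_mem _ fun l _ => Submodule.smul_mem _ _
          (Submodule.subset_span ⟨l, rfl⟩)
      · rw [hcoef]
        have h1 : ∀ l, ‖opMatrix Ψ.rangeProj k l * c.1 l‖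
            ≤ ‖opMatrix Ψ.rangeProj k l‖ * (w l)⁻¹ * ‖c‖ := by
          intro l
          rw [norm_mul, mul_assoc]
          gcongr
          rw [← div_eq_inv_mul, le_div_iff₀ (w.pos l), mul_comm]
          exact WeightedLp.norm_mul_apply_le c l
        have h2 : ‖∑ l ∈ F n, opMatrix Ψ.rangeProj k l * c.1 l‖ ≤ C * (w k)⁻¹ * ‖c‖ := by
          refine (norm_sum_le_of_le _ fun l _ => h1 l).trans ?_
          rw [← Finset.sum_mul]
          gcongr
          refine ((hC k).1.sum_le_tsum _ fun l _ => ?_).trans (hC k).2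
          exact mul_nonneg (norm_nonneg _) (inv_nonneg.2 (w.pos l).le)
        calc w k * _ ≤ w k * (C * (w k)⁻¹ * ‖c‖) := by
              have := (w.pos k).le
              gcongr
          _ = C * ‖c‖ := by
              have := (w.pos k).ne'
              field_simp
      · simp only [hcoef]
        have h1 := ARIAlgebra.hasSum_act hP hw c k
        rw [hc, HasSum, SummationFilter.unconditional_filter] at h1
        exact h1.comp hF
  · rw [CoorbitSpace, if_neg hp]
    constructor
    · intro hc
      have hclosed : IsClosed {c : WeightedLp w p | ARIAlgebra.act hP hw p c = c} :=
        isClosed_eq (ARIAlgebra.act hP hw p).continuous continuous_id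
      have hsub : (finCoorbit Ψ p w : Set (WeightedLp w p))
          ⊆ {c : WeightedLp w p | ARIAlgebra.act hP hw p c = c} := by
        rintro d ⟨f, -, hf⟩
        exact Ψ.act_rangeProj_eq_of_eq_dualCoeff hP hw hf.symm
      exact closure_minimal hsub hclosed hc
    · intro hc
      -- Applying P to the expansion of c in unit vectors gives c = P c as a norm limit of
      -- combinations of P δ_l, the coefficient sequences of ψ_l.
      have h1 := (WeightedLp.hasSum_smul_delta hp c).mapL (ARIAlgebra.act hP hw p)
      rw [hc] at h1
      refine mem_closure_of_tendsto h1 (Filter.Eventually.of_forall fun s => ?_)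
      refine Submodule.sum_mem _ fun l _ => ?_
      rw [map_smul]
      refine Submodule.smul_mem _ _ ⟨Ψ.vec l, Submodule.subset_span ⟨l, rfl⟩, ?_⟩
      exact (Ψ.act_rangeProj_delta hP hw p l).symm

theorem completeSpace_coorbitSpace [Countable K] (hP : Ψ.rangeProj ∈ A.alg) (hw : w ∈ A.W)
    (p : ℝ≥0∞) [Fact (1 ≤ p)] : CompleteSpace (CoorbitSpace Ψ p w) := by
  have h : (CoorbitSpace Ψ p w : Set (WeightedLp w p))
      = {c | ARIAlgebra.act hP hw p c = c} := by
    ext c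
    exact Ψ.mem_coorbitSpace_iff hP hw c
  have hclosed : IsClosed (CoorbitSpace Ψ p w : Set (WeightedLp w p)) := by
    rw [h]
    exact isClosed_eq (ARIAlgebra.act hP hw p).continuous continuous_id
  exact hclosed.completeSpace_coe

/-- The projection of `ℓ^p_w` onto the coorbit space. -/
def coorbitProj [Countable K] (hP : Ψ.rangeProj ∈ A.alg) (hw : w ∈ A.W) (p : ℝ≥0∞)
    [Fact (1 ≤ p)] : WeightedLp w p →L[ℂ] CoorbitSpace Ψ p w :=
  (ARIAlgebra.act hP hw p).codRestrict _ fun c =>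
    (Ψ.mem_coorbitSpace_iff hP hw _).2 (Ψ.act_rangeProj_idem hP hw c)

theorem frameCoeff_eq_act (hG : Ψ.gramOp ∈ A.alg) (hw : w ∈ A.W) {p : ℝ≥0∞} [Fact (1 ≤ p)]
    (c : WeightedLp w p) (k : K) : frameCoeff Ψ c.1 k = (ARIAlgebra.act hG hw p c).1 k := by
  have h := ARIAlgebra.hasSum_act hG hw c k
  rw [opMatrix_gramOp] at h
  simp only [mul_comm (Ψ.gram _ _)] at h
  exact h.tsum_eq

theorem summable_mul_gram (hG : Ψ.gramOp ∈ A.alg) (hw : w ∈ A.W) {p : ℝ≥0∞} [Fact (1 ≤ p)]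
    (c : WeightedLp w p) (k : K) : Summable fun l => c.1 l * ⟪Ψ.vec k, Ψ.vec l⟫_ℂ := by
  have h := ARIAlgebra.hasSum_act hG hw c k
  rw [opMatrix_gramOp] at h
  simp only [mul_comm (Ψ.gram _ _)] at h
  exact h.summable

theorem conj_opMatrix_rangeProj (k l : K) :
    conj (opMatrix Ψ.rangeProj k l) = opMatrix Ψ.rangeProj l k := by
  rw [← opMatrix_adjoint, adjoint_rangeProj]

/-- The frame multiplier `M_μ = P diag(μ) G` as a map between coorbit spaces. -/
def multiplier [Countable K] (hG : Ψ.gramOp ∈ A.alg) {w₁ w₂ : PosWeight K} (hw₁ : w₁ ∈ A.W)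
    (hw₂ : w₂ ∈ A.W) (p : ℝ≥0∞) [Fact (1 ≤ p)] :
    CoorbitSpace Ψ p w₁ →L[ℂ] CoorbitSpace Ψ p w₂ :=
  (Ψ.coorbitProj (Ψ.rangeProj_mem hG) hw₂ p) ∘L
    (WeightedLp.changeWeight w₁ w₂ p : WeightedLp w₁ p →L[ℂ] WeightedLp w₂ p) ∘L
    (ARIAlgebra.act hG hw₁ p) ∘L (CoorbitSpace Ψ p w₁).subtypeL

theorem multiplier_coe [Countable K] (hG : Ψ.gramOp ∈ A.alg) {w₁ w₂ : PosWeight K}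
    (hw₁ : w₁ ∈ A.W) (hw₂ : w₂ ∈ A.W) (p : ℝ≥0∞) [Fact (1 ≤ p)] (c : CoorbitSpace Ψ p w₁) :
    (Ψ.multiplier hG hw₁ hw₂ p c).1 = ARIAlgebra.act (Ψ.rangeProj_mem hG) hw₂ p
      (WeightedLp.changeWeight w₁ w₂ p (ARIAlgebra.act hG hw₁ p c.1)) := rfl

theorem act_rangeProj_act_gramOp (hG : Ψ.gramOp ∈ A.alg) (hw : w ∈ A.W) {p : ℝ≥0∞}
    [Fact (1 ≤ p)] (c : WeightedLp w p) :
    ARIAlgebra.act (Ψ.rangeProj_mem hG) hw p (ARIAlgebra.act hG hw p c)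
      = ARIAlgebra.act hG hw p c :=
  ARIAlgebra.act_mul_of_eq _ _ _ Ψ.rangeProj_mul_gramOp hw c

/-- The weak-`*` pairing of `P d` with a sequence `h` in the range of `P`. -/
theorem hasSum_act_rangeProj_mul_conj (hP : Ψ.rangeProj ∈ A.alg) (hw : w ∈ A.W)
    (hw' : w⁻¹ ∈ A.W) (d : WeightedLp w ∞) {h : WeightedLp w⁻¹ 1}
    (hh : ARIAlgebra.act hP hw' 1 h = h) :
    ∃ s, HasSum (fun k => (ARIAlgebra.act hP hw ∞ d).1 k * (starRingEnd ℂ) (h.1 k)) s ∧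
      HasSum (fun l => d.1 l * (starRingEnd ℂ) (h.1 l)) s := by
  have ha : Summable fun j => ‖(starRingEnd ℂ) (h.1 j)‖ * (w j)⁻¹ := by
    simpa only [RCLike.norm_conj] using WeightedLp.summable_norm_mul_inv h
  -- Both pairings are iterated sums of one absolutely convergent double series: since P is
  -- self-adjoint, ⟨P d, h⟩ = ⟨d, P h⟩ = ⟨d, h⟩.
  have hs := (ARIAlgebra.summable_mul_opMatrix_mul hP hw ha d).hasSum
  refine ⟨∑' x : K × K, (starRingEnd ℂ) (h.1 x.1) * (opMatrix Ψ.rangeProj x.1 x.2 * d.1 x.2),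
    ?_, ?_⟩
  rotate_left
  · refine HasSum.prod_fiberwise ((Equiv.prodComm K K).hasSum_iff.2 hs) fun l => ?_
    have h1 := ARIAlgebra.hasSum_act hP hw' h l
    rw [hh] at h1
    have h2 := (Complex.hasSum_conj'.2 h1).mul_left (d.1 l)
    have h3 : ∀ k, (starRingEnd ℂ) (h.1 k) * (opMatrix Ψ.rangeProj k l * d.1 l)
        = d.1 l * conj (opMatrix Ψ.rangeProj l k * h.1 k) := by
      intro k
      rw [map_mul, conj_opMatrix_rangeProj]
      ring
    simp only [← h3] at h2
    exact h2
  · have h1 := hs.prod_fiberwise fun j =>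
      (ARIAlgebra.hasSum_act hP hw d j).mul_left ((starRingEnd ℂ) (h.1 j))
    exact (funext fun j => mul_comm _ _ : (fun k => (ARIAlgebra.act hP hw ∞ d).1 k *
      (starRingEnd ℂ) (h.1 k)) = _) ▸ h1

theorem isFrameMultiplier_multiplier [Countable K] (hG : Ψ.gramOp ∈ A.alg) {μ w₁ w₂ : PosWeight K}
    (hw₁ : w₁ ∈ A.W) (hw₂ : w₂ ∈ A.W) (hw : ∀ k, w₁ k = μ k * w₂ k) (p : ℝ≥0∞) [Fact (1 ≤ p)] :
    IsFrameMultiplier Ψ μ (Ψ.multiplier hG hw₁ hw₂ p) := by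
  have hP := Ψ.rangeProj_mem hG
  refine ⟨fun k => Ψ.coorbitProj hP hw₂ p (WeightedLp.delta w₂ p k),
    fun k => Ψ.act_rangeProj_delta hP hw₂ p k, fun f =>
    ⟨fun k => Ψ.summable_mul_gram hG hw₁ f.1 k, fun hp => ?_, fun hp g => ?_⟩⟩
  -- The expansion of diag(μ) G f in unit vectors converges unconditionally for p < ∞, and P maps it
  -- term by term to the multiplier series.
  · have h1 := (WeightedLp.hasSum_smul_delta hp (WeightedLp.changeWeight w₁ w₂ p
      (ARIAlgebra.act hG hw₁ p f.1))).mapL (Ψ.coorbitProj hP hw₂ p)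
    simp only [map_smul, WeightedLp.changeWeight_apply p hw, ← frameCoeff_eq_act] at h1
    exact h1
  · subst hp
    have hw₂' := A.inv_mem w₂ hw₂
    set h := ARIAlgebra.act hG hw₂' 1 g.1 with hh
    have hPh : ARIAlgebra.act hP hw₂' 1 h = h := Ψ.act_rangeProj_act_gramOp hG hw₂' g.1
    have hgh : ∀ k, frameCoeff Ψ g.1.1 k = h.1 k := Ψ.frameCoeff_eq_act hG hw₂' g.1
    obtain ⟨s, hs1, hs2⟩ := Ψ.hasSum_act_rangeProj_mul_conj hP hw₂ hw₂'
      (WeightedLp.changeWeight w₁ w₂ ∞ (ARIAlgebra.act hG hw₁ ∞ f.1)) hPh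
    -- With h = G g fixed by P, pairing ψ_k with g returns the conjugate of h_k, so the weak-*
    -- series becomes the pairing of diag(μ) G f with h.
    have he : ∀ k, coorbitPairing Ψ
        (Ψ.coorbitProj hP hw₂ ∞ (WeightedLp.delta w₂ ∞ k)).1.1 g.1.1 = (starRingEnd ℂ) (h.1 k) := by
      intro k
      have h1 := ARIAlgebra.hasSum_act hP hw₂' h k
      rw [hPh] at h1
      have h2 := Complex.hasSum_conj'.2 h1
      have h4 : ∀ j, Ψ.dualCoeff (Ψ.vec k) j * (starRingEnd ℂ) (h.1 j)
          = conj (opMatrix Ψ.rangeProj k j * h.1 j) := by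
        intro j
        rw [map_mul, conj_opMatrix_rangeProj, opMatrix_rangeProj]
        rfl
      simp only [← h4] at h2
      have h3 : (Ψ.coorbitProj hP hw₂ ∞ (WeightedLp.delta w₂ ∞ k)).1.1
          = Ψ.dualCoeff (Ψ.vec k) := Ψ.act_rangeProj_delta hP hw₂ ∞ k
      rw [coorbitPairing, h3]
      simp only [hgh]
      exact h2.tsum_eq
    have hT : coorbitPairing Ψ (Ψ.multiplier hG hw₁ hw₂ ∞ f).1.1 g.1.1 = s := by
      rw [coorbitPairing]
      simp only [hgh]
      exact hs1.tsum_eq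
    simp only [he, hT]
    simp only [hgh]
    refine ⟨hs1.summable, ?_⟩
    simp only [WeightedLp.changeWeight_apply ∞ hw, ← frameCoeff_eq_act] at hs2
    exact hs2

theorem changeWeight_act_changeWeight (hG : Ψ.gramOp ∈ A.alg) {μ w₁ w₂ : PosWeight K}
    (hw₁ : w₁ ∈ A.W) (hw₂ : w₂ ∈ A.W) (hw : ∀ k, w₁ k = μ k * w₂ k)
    {N : lp (fun _ : K => ℂ) 2 →L[ℂ] lp (fun _ : K => ℂ) 2} (hN : N ∈ A.alg)
    (hNG : IsWeightConj μ⁻¹ Ψ.gramOp N) {p : ℝ≥0∞} [Fact (1 ≤ p)] (c : WeightedLp w₁ p) :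
    WeightedLp.changeWeight w₂ w₁ p (ARIAlgebra.act hG hw₂ p (WeightedLp.changeWeight w₁ w₂ p c))
      = ARIAlgebra.act hN hw₁ p c := by
  have hw' : ∀ k, w₂ k = (μ⁻¹ : PosWeight K) k * w₁ k := fun k => by
    have h : (μ⁻¹ : PosWeight K) k = (μ k)⁻¹ := rfl
    rw [h, hw, inv_mul_cancel_left₀ (μ.pos k).ne']
  refine WeightedLp.ext' fun k => ?_
  rw [WeightedLp.changeWeight_apply p hw']
  refine HasSum.unique ?_ (ARIAlgebra.hasSum_act hN hw₁ c k)
  have h1 := (ARIAlgebra.hasSum_act hG hw₂ (WeightedLp.changeWeight w₁ w₂ p c) k).mul_left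
    ((μ⁻¹ : PosWeight K) k : ℂ)
  have h2 : ∀ l, ((μ⁻¹ : PosWeight K) k : ℂ) *
      (opMatrix Ψ.gramOp k l * (WeightedLp.changeWeight w₁ w₂ p c).1 l)
      = opMatrix N k l * c.1 l := by
    intro l
    have h3 : ((μ⁻¹ : PosWeight K) l : ℂ) = (μ l : ℂ)⁻¹ := Complex.ofReal_inv _
    rw [WeightedLp.changeWeight_apply p hw, hNG, h3, inv_inv]
    ring
  simp only [h2] at h1
  exact h1

/-- The middle projection is absorbed by G P = G, and the two diagonal factors around G combine to
N, leaving P N G. -/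
theorem multiplier_multiplier [Countable K] (hG : Ψ.gramOp ∈ A.alg) {μ w₁ w₂ : PosWeight K}
    (hw₁ : w₁ ∈ A.W) (hw₂ : w₂ ∈ A.W) (hw : ∀ k, w₁ k = μ k * w₂ k)
    {N : lp (fun _ : K => ℂ) 2 →L[ℂ] lp (fun _ : K => ℂ) 2} (hN : N ∈ A.alg)
    (hNG : IsWeightConj μ⁻¹ Ψ.gramOp N) (hX : Ψ.rangeProj * N * Ψ.gramOp ∈ A.alg)
    {p : ℝ≥0∞} [Fact (1 ≤ p)] (c : CoorbitSpace Ψ p w₁) :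
    (Ψ.multiplier hG hw₂ hw₁ p (Ψ.multiplier hG hw₁ hw₂ p c)).1
      = ARIAlgebra.act hX hw₁ p c.1 := by
  have hP := Ψ.rangeProj_mem hG
  rw [multiplier_coe, multiplier_coe,
    ARIAlgebra.act_mul_of_eq hG hP hG Ψ.gramOp_mul_rangeProj hw₂,
    Ψ.changeWeight_act_changeWeight hG hw₁ hw₂ hw hN hNG,
    ARIAlgebra.act_mul_of_eq hN hG (mul_mem hN hG) rfl,
    ARIAlgebra.act_mul_of_eq hP (mul_mem hN hG) hX (mul_assoc _ _ _).symm]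

/-- `M_{1/μ} M_μ` is bijective on the coorbit space. -/
theorem bijective_multiplier_comp_multiplier [Countable K] (hG : Ψ.gramOp ∈ A.alg)
    {μ w₁ w₂ : PosWeight K} (hμ : μ ∈ A.W)
    (hw₁ : w₁ ∈ A.W) (hw₂ : w₂ ∈ A.W) (hw : ∀ k, w₁ k = μ k * w₂ k)
    {N : lp (fun _ : K => ℂ) 2 →L[ℂ] lp (fun _ : K => ℂ) 2} (hN : N ∈ A.alg)
    (hNG : IsWeightConj μ⁻¹ Ψ.gramOp N) (p : ℝ≥0∞) [Fact (1 ≤ p)] :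
    Function.Bijective (Ψ.multiplier hG hw₂ hw₁ p ∘ Ψ.multiplier hG hw₁ hw₂ p) := by
  have hP := Ψ.rangeProj_mem hG
  have hX : Ψ.rangeProj * N * Ψ.gramOp ∈ A.alg := mul_mem (mul_mem hP hN) hG
  obtain ⟨R, hR, hRX, hXR, hPR⟩ := Ψ.exists_inverse_rangeProj_mul hμ hG hN hNG
  have key : ∀ c, (Ψ.multiplier hG hw₂ hw₁ p (Ψ.multiplier hG hw₁ hw₂ p c)).1
      = ARIAlgebra.act hX hw₁ p c.1 := Ψ.multiplier_multiplier hG hw₁ hw₂ hw hN hNG hX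
  have hfix : ∀ c : CoorbitSpace Ψ p w₁, ARIAlgebra.act hP hw₁ p c.1 = c.1 := fun c =>
    (Ψ.mem_coorbitSpace_iff hP hw₁ c.1).1 c.2
  constructor
  · intro c d hcd
    have h1 : ARIAlgebra.act hX hw₁ p c.1 = ARIAlgebra.act hX hw₁ p d.1 := by
      rw [← key, ← key]; exact congrArg Subtype.val hcd
    have h2 := congrArg (ARIAlgebra.act hR hw₁ p) h1
    rw [ARIAlgebra.act_mul_of_eq hR hX hP hRX, ARIAlgebra.act_mul_of_eq hR hX hP hRX, hfix,
      hfix] at h2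
    exact Subtype.ext h2
  · intro c
    refine ⟨⟨ARIAlgebra.act hR hw₁ p c.1, (Ψ.mem_coorbitSpace_iff hP hw₁ _).2
      (ARIAlgebra.act_mul_of_eq hP hR hR hPR hw₁ c.1)⟩, Subtype.ext ?_⟩
    rw [Function.comp_apply, key, ARIAlgebra.act_mul_of_eq hX hR hP hXR, hfix]

/-- The frame multipliers `M_μ` and `M_{1/μ}` are bijective if both `G^{1/μ}` and `G^μ` belong to
the algebra. -/
theorem bijective_multiplier [Countable K] (hG : Ψ.gramOp ∈ A.alg)
    {μ w₁ w₂ : PosWeight K} (hμ : μ ∈ A.W) (hw₁ : w₁ ∈ A.W) (hw₂ : w₂ ∈ A.W)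
    (hw : ∀ k, w₁ k = μ k * w₂ k)
    {N N' : lp (fun _ : K => ℂ) 2 →L[ℂ] lp (fun _ : K => ℂ) 2} (hN : N ∈ A.alg)
    (hN' : N' ∈ A.alg) (hNG : IsWeightConj μ⁻¹ Ψ.gramOp N) (hNG' : IsWeightConj μ Ψ.gramOp N')
    (p : ℝ≥0∞) [Fact (1 ≤ p)] :
    Function.Bijective (Ψ.multiplier hG hw₁ hw₂ p) ∧
      Function.Bijective (Ψ.multiplier hG hw₂ hw₁ p) := by
  have hinv : (μ⁻¹)⁻¹ = μ := by
    obtain ⟨a, ha⟩ := μ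
    change PosWeight.mk (fun k => (a k)⁻¹⁻¹) _ = PosWeight.mk a ha
    simp only [inv_inv]
  have hw' : ∀ k, w₂ k = (μ⁻¹ : PosWeight K) k * w₁ k := fun k => by
    have h : (μ⁻¹ : PosWeight K) k = (μ k)⁻¹ := rfl
    rw [h, hw, inv_mul_cancel_left₀ (μ.pos k).ne']
  have h1 := Ψ.bijective_multiplier_comp_multiplier hG hμ hw₁ hw₂ hw hN hNG p
  have h2 := Ψ.bijective_multiplier_comp_multiplier hG (A.inv_mem μ hμ) hw₂ hw₁ hw' hN'
    (by rwa [hinv]) p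
  -- Injectivity of each multiplier comes from the composite in which it acts first, surjectivity
  -- from the one in which it acts last.
  exact ⟨⟨h1.1.of_comp, h2.2.of_comp⟩, ⟨h2.1.of_comp, h1.2.of_comp⟩⟩

end HilbertFrame

end

/-! ### The lifting theorem -/

theorem mainTheorem1 {K : Type*} [Countable K] {H : Type*} [NormedAddCommGroup H]
    [InnerProductSpace ℂ H] [CompleteSpace H]
    (A : ARIAlgebra K) (μ m : PosWeight K)
    (hμ : μ ∈ A.W) (hm₁ : m * μ.sqrt ∈ A.W) (hm₂ : m / μ.sqrt ∈ A.W)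
    (Ψ : HilbertFrame K H) (hΨ : A.MemMatrix Ψ.gram) (hΨμ : A.MemMatrix (conjDiag μ Ψ.gram))
    (p : ℝ≥0∞) [Fact (1 ≤ p)] :
    (CompleteSpace (CoorbitSpace Ψ p (m * μ.sqrt)) ∧
      CompleteSpace (CoorbitSpace Ψ p (m / μ.sqrt))) ∧
    (∃ T : CoorbitSpace Ψ p (m * μ.sqrt) ≃L[ℂ] CoorbitSpace Ψ p (m / μ.sqrt),
      IsFrameMultiplier Ψ μ T) ∧
    (∃ S : CoorbitSpace Ψ p (m / μ.sqrt) ≃L[ℂ] CoorbitSpace Ψ p (m * μ.sqrt),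
      IsFrameMultiplier Ψ μ⁻¹ S) := by
  have hG : Ψ.gramOp ∈ A.alg := by
    obtain ⟨T, hT, hTG⟩ := hΨ
    rwa [← opMatrix_injective (hTG.trans Ψ.opMatrix_gramOp.symm)]
  obtain ⟨N', hN', hNG⟩ := hΨμ
  rw [← Ψ.opMatrix_gramOp] at hNG
  have hNG' : IsWeightConj μ Ψ.gramOp N' := IsWeightConj.of_eq_conjDiag hNG
  -- As G is self-adjoint, G^{1/μ} is the adjoint of G^μ and so lies in the algebra without a
  -- separate hypothesis.
  have hNG'' : IsWeightConj μ⁻¹ Ψ.gramOp N'.adjoint := by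
    have h := hNG'.adjoint.symm
    rwa [Ψ.adjoint_gramOp] at h
  have hN : N'.adjoint ∈ A.alg := star_mem hN'
  have hP := Ψ.rangeProj_mem hG
  have hw : ∀ k, (m * μ.sqrt) k = μ k * (m / μ.sqrt) k := by
    intro k
    have h1 : (m * μ.sqrt) k = m k * μ.sqrt k := rfl
    have h2 : (m / μ.sqrt) k = m k / μ.sqrt k := rfl
    have h3 := (μ.sqrt.pos k).ne'
    rw [h1, h2, ← μ.sqrt_mul_sqrt]
    field_simp
  have hw' : ∀ k, (m / μ.sqrt) k = (μ⁻¹ : PosWeight K) k * (m * μ.sqrt) k := fun k => by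
    have h : (μ⁻¹ : PosWeight K) k = (μ k)⁻¹ := rfl
    rw [h, hw, inv_mul_cancel_left₀ (μ.pos k).ne']
  have hc₁ := Ψ.completeSpace_coorbitSpace hP hm₁ p
  have hc₂ := Ψ.completeSpace_coorbitSpace hP hm₂ p
  obtain ⟨hb₁, hb₂⟩ := Ψ.bijective_multiplier hG hμ hm₁ hm₂ hw hN hN' hNG'' hNG' p
  refine ⟨⟨hc₁, hc₂⟩, ⟨ContinuousLinearEquiv.ofBijective (Ψ.multiplier hG hm₁ hm₂ p)
    (LinearMap.ker_eq_bot.2 hb₁.1) (LinearMap.range_eq_top.2 hb₁.2), ?_⟩,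
    ⟨ContinuousLinearEquiv.ofBijective (Ψ.multiplier hG hm₂ hm₁ p)
    (LinearMap.ker_eq_bot.2 hb₂.1) (LinearMap.range_eq_top.2 hb₂.2), ?_⟩⟩
  · exact Ψ.isFrameMultiplier_multiplier hG hm₁ hm₂ hw p
  · exact Ψ.isFrameMultiplier_multiplier hG hm₂ hm₁ hw' p
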